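/- Let $D\subsetneq\mathbb C$ be a nice domain, i.e. an open, connected and simply connected set which is symmetric with respect to the real axis ($z\in D\Rightarrow\bar z\in D$), and suppose that $[-1,1]\subset D$. Write $\mathbb D=\{z\in\mathbb C:|z|<1\}$ and, for $w,z\in\mathbb D$, $$m(w,z)=\left|\frac{w-z}{1-\bar w z}\right|,\qquad p(w,z)=\frac12\ln\frac{1+m(w,z)}{1-m(w,z)}.$$ For $w,z\in D$ let $$c_D(w,z)=\sup\{p(F(w),F(z)) : F:D\to\mathbb D\text{ holomorphic}\},\qquad c_D^*(w,z)=\tanh c_D(w,z),$$ and put $$\delta_D=\sup_{x\in[-1,1]}\ \inf\{|x-\zeta| : \zeta\in\mathbb C\setminus D\}.$$ Then there is a biholomorphic map $f_D:D\to\mathbb D$ with $f_D(0)=0$ and $f_D([0,1])\subset[0,1)$. Moreover, with $L=1/4$, and also with $L=1/2$ if $D$ is in addition convex, for all $w,z\in[-1,1]$ $$c_D(w,z)\ \ge\ \frac{L}{\delta_D}\,|w-z| ,$$ and, for every such $f_D$, $$m(f_D(w),f_D(z))=c_D^*(w,z)=\tanh c_D(w,z)\ \ge\ \frac{\exp\left(\frac{2L|w-z|}{\delta_D}\right)-1}{\exp\left(\frac{2L|w-z|}{\delta_D}\right)+1}=\tanh\frac{L|w-z|}{\delta_D}.$$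 -/

import Mathlib

noncomputable section

/-- A nice domain: an open, connected and simply connected subset of the complex plane that is
symmetric with respect to the real axis. -/
structure IsNiceDomain (D : Set ℂ) : Prop where
  isOpen : IsOpen D
  isConnected : IsConnected D
  isSimplyConnected : IsSimplyConnected D
  symmetric : ∀ z ∈ D, (starRingEnd ℂ) z ∈ D

/-- The set `𝒪(D, G)` of holomorphic maps from the open set `D` to `G`; a map is represented by a
function on `ℂ` of which only the values on `D` matter. -/
def holomorphicMaps (D G : Set ℂ) : Set (ℂ → ℂ) :=
  {F | DifferentiableOn ℂ F D ∧ Set.MapsTo F D G}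

/-- The open unit disk. -/
def unitDisk : Set ℂ := {z | ‖z‖ < 1}

/-- The Möbius (pseudohyperbolic) distance `m(w, z) = |(w - z) / (1 - w̄ z)|` on the unit disk. -/
def mobiusDist (w z : ℂ) : ℝ := ‖(w - z) / (1 - (starRingEnd ℂ) w * z)‖

/-- The Poincaré distance on the unit disk, normalised as `p = artanh m`. -/
def poincareDist (w z : ℂ) : ℝ :=
  (1 / 2) * Real.log ((1 + mobiusDist w z) / (1 - mobiusDist w z))

/-- The Carathéodory pseudodistance `c_D`. (For a domain `D` and `w z ∈ D` the set below is
non-empty and bounded.) -/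
def caratheodoryDist (D : Set ℂ) (w z : ℂ) : ℝ :=
  sSup {r : ℝ | ∃ F ∈ holomorphicMaps D unitDisk, r = poincareDist (F w) (F z)}

/-- `c_D^* = tanh c_D`. -/
def caratheodoryStar (D : Set ℂ) (w z : ℂ) : ℝ := Real.tanh (caratheodoryDist D w z)

/-- `δ_D(x) = inf {|x - z| : z ∈ ℂ \ D}`. -/
def boundaryDistAt (D : Set ℂ) (x : ℂ) : ℝ := sInf {r : ℝ | ∃ z ∈ Dᶜ, r = ‖x - z‖}

/-- `δ_D = sup {δ_D(x) : x ∈ [-1, 1]}`. -/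
def boundaryDist (D : Set ℂ) : ℝ :=
  sSup {r : ℝ | ∃ x ∈ Set.Icc (-1 : ℝ) 1, r = boundaryDistAt D (x : ℂ)}

/-- `f` restricts to a biholomorphic (conformal) map from `U` onto `V`. -/
def IsBiholomorphic (f : ℂ → ℂ) (U V : Set ℂ) : Prop :=
  f ∈ holomorphicMaps U V ∧
    ∃ g ∈ holomorphicMaps V U, (∀ z ∈ U, g (f z) = z) ∧ ∀ z ∈ V, f (g z) = z

/-- `f` is the normalised conformal map `f_D : D → 𝔻`, that is `f 0 = 0` and
`f([0, 1]) ⊆ [0, 1)`. -/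
structure IsNormalizedRiemannMap (D : Set ℂ) (f : ℂ → ℂ) : Prop where
  isBiholomorphic : IsBiholomorphic f D unitDisk
  map_zero : f 0 = 0
  map_Icc : ∀ x ∈ Set.Icc (0 : ℝ) 1, ∃ y ∈ Set.Ico (0 : ℝ) 1, f (x : ℂ) = (y : ℂ)

end

open Complex Metric Set Filter MeasureTheory
open scoped ComplexConjugate Topology

/-! By Schwarz–Pick, a biholomorphism `f` onto the disk attains the supremum defining `c_D`, so
`c_D(w, z) = p(f w, f z)` for every Riemann map `f`. If `f` is real on the real axis, then on `[-1,
1]` this is the increment of `artanh ∘ f`, whose derivative has absolute value equal to the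
hyperbolic density `|f'| / (1 - |f|²)`. It therefore suffices to show that the density at `x` is at
least `L / |x - ζ|` for each `ζ ∉ D`; the bound by `L / δ_D` follows, and `tanh` gives the second
form.

For the density, take a univalent `φ : 𝔻 → D` onto `D` with `φ 0 = x`; the density is `1 / |φ'(0)|`.
If `D` is convex, it lies in a half-plane omitting `ζ`, and the Schwarz lemma for the Cayley map
composed with `φ` gives `L = 1/2`. In general a branch `s` of `√(z - ζ)` has `s(D)` disjoint from
`-s(D)`, so `β = (s x - s) / (s x + s)` is univalent and never satisfies `β z * β w = 1`. For such
functions `norm_deriv_le_one_of_mul_ne_one` bounds the derivative of `β ∘ φ` at `0` by one, and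
`|β'(x)| = 1 / (4|x - ζ|)` yields `L = 1/4`. The derivative bound is an area comparison for the
metric `|dw| / |w|`: the image of an annulus and its inversion are disjoint, have equal area, and
fit in one common annulus.

Riemann maps come from the usual extremal problem, with Montel's theorem along an ultrafilter and
Hurwitz's theorem. Symmetry of `D` and uniqueness up to rotation make the map real on the axis. -/

theorem unitDisk_eq_ball : unitDisk = ball (0 : ℂ) 1 := by
  ext z; simp [unitDisk]

/-! ### Automorphisms of the disk and the Schwarz–Pick lemma. -/

theorem one_sub_conj_mul_ne_zero {a z : ℂ} (ha : ‖a‖ < 1) (hz : ‖z‖ < 1) :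
    1 - conj a * z ≠ 0 := by
  intro h
  have h1 : ‖conj a * z‖ = 1 := by rw [← sub_eq_zero.mp h]; simp
  rw [norm_mul, RCLike.norm_conj] at h1
  nlinarith [norm_nonneg a, norm_nonneg z]

/-- The automorphism `z ↦ (z - a) / (1 - ā z)` of the unit disk. -/
noncomputable def diskMobius (a z : ℂ) : ℂ := (z - a) / (1 - conj a * z)

@[simp] theorem diskMobius_self (a : ℂ) : diskMobius a a = 0 := by simp [diskMobius]

theorem diskMobius_zero_right (a : ℂ) : diskMobius a 0 = -a := by simp [diskMobius]

theorem mobiusDist_eq_norm_diskMobius (a z : ℂ) : mobiusDist a z = ‖diskMobius a z‖ := by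
  rw [mobiusDist, diskMobius, norm_div, norm_div, norm_sub_rev]

theorem one_sub_normSq_diskMobius {a z : ℂ} (ha : ‖a‖ < 1) (hz : ‖z‖ < 1) :
    1 - normSq (diskMobius a z) =
      (1 - normSq a) * (1 - normSq z) / normSq (1 - conj a * z) := by
  have h : normSq (1 - conj a * z) ≠ 0 := normSq_eq_zero.not.mpr (one_sub_conj_mul_ne_zero ha hz)
  rw [diskMobius, normSq_div, eq_div_iff h, sub_mul, div_mul_cancel₀ _ h]
  simp only [normSq_apply, sub_re, sub_im, one_re, one_im, mul_re, mul_im, conj_re, conj_im]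
  ring

theorem norm_diskMobius_lt_one {a z : ℂ} (ha : ‖a‖ < 1) (hz : ‖z‖ < 1) :
    ‖diskMobius a z‖ < 1 := by
  have h := one_sub_normSq_diskMobius ha hz
  have h0 : 0 < normSq (1 - conj a * z) := normSq_pos.mpr (one_sub_conj_mul_ne_zero ha hz)
  have h1 : 0 < 1 - normSq a := by
    rw [normSq_eq_norm_sq]; nlinarith [norm_nonneg a]
  have h2 : 0 < 1 - normSq z := by
    rw [normSq_eq_norm_sq]; nlinarith [norm_nonneg z]
  have h3 : 0 < 1 - normSq (diskMobius a z) := by rw [h]; positivity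
  rw [normSq_eq_norm_sq] at h3
  nlinarith [norm_nonneg (diskMobius a z)]

theorem diskMobius_neg_diskMobius {a z : ℂ} (ha : ‖a‖ < 1) (hz : ‖z‖ < 1) :
    diskMobius (-a) (diskMobius a z) = z := by
  have h := one_sub_conj_mul_ne_zero ha hz
  have h' := one_sub_conj_mul_ne_zero ha ha
  have e1 : diskMobius a z + a = z * (1 - conj a * a) / (1 - conj a * z) := by
    rw [diskMobius, eq_div_iff h, add_mul, div_mul_cancel₀ _ h]; ring
  have e2 : 1 + conj a * diskMobius a z = (1 - conj a * a) / (1 - conj a * z) := by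
    rw [diskMobius, eq_div_iff h, add_mul, mul_assoc, div_mul_cancel₀ _ h]; ring
  rw [diskMobius, sub_neg_eq_add, map_neg, neg_mul, sub_neg_eq_add, e1, e2,
    div_div_div_cancel_right₀ h, mul_div_cancel_right₀ _ h']

theorem diskMobius_diskMobius_neg {a z : ℂ} (ha : ‖a‖ < 1) (hz : ‖z‖ < 1) :
    diskMobius a (diskMobius (-a) z) = z := by
  simpa using diskMobius_neg_diskMobius (a := -a) (by simpa using ha) hz

theorem mapsTo_diskMobius {a : ℂ} (ha : ‖a‖ < 1) :
    MapsTo (diskMobius a) (ball 0 1) (ball 0 1) := fun z hz ↦ by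
  rw [mem_ball_zero_iff] at *
  exact norm_diskMobius_lt_one ha hz

theorem injOn_diskMobius {a : ℂ} (ha : ‖a‖ < 1) : InjOn (diskMobius a) (ball 0 1) :=
  LeftInvOn.injOn (f₁' := diskMobius (-a)) fun _ hz ↦
    diskMobius_neg_diskMobius ha (mem_ball_zero_iff.mp hz)

theorem hasDerivAt_diskMobius {a z : ℂ} (ha : ‖a‖ < 1) (hz : ‖z‖ < 1) :
    HasDerivAt (diskMobius a) ((1 - conj a * a) / (1 - conj a * z) ^ 2) z := by
  have h := one_sub_conj_mul_ne_zero ha hz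
  have h1 : HasDerivAt (fun w ↦ 1 - conj a * w) (-conj a) z := by
    simpa using ((hasDerivAt_id z).const_mul (conj a)).const_sub 1
  refine (((hasDerivAt_id z).sub_const a).div h1 h).congr_deriv ?_
  congr 1
  simp
  ring

theorem hasDerivAt_diskMobius_self {a : ℂ} (ha : ‖a‖ < 1) :
    HasDerivAt (diskMobius a) (1 / (1 - ‖a‖ ^ 2 : ℝ)) a := by
  convert! hasDerivAt_diskMobius ha ha using 1
  have h := one_sub_conj_mul_ne_zero ha ha
  rw [← normSq_eq_conj_mul_self, normSq_eq_norm_sq] at *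
  push_cast at *
  field_simp

theorem differentiableOn_diskMobius {a : ℂ} (ha : ‖a‖ < 1) :
    DifferentiableOn ℂ (diskMobius a) (ball 0 1) := fun _ hz ↦
  (hasDerivAt_diskMobius ha (mem_ball_zero_iff.mp hz)).differentiableAt.differentiableWithinAt

/-- The **Schwarz–Pick lemma**. -/
theorem mobiusDist_le_mobiusDist_of_mapsTo {f : ℂ → ℂ} (hf : DifferentiableOn ℂ f (ball 0 1))
    (hm : MapsTo f (ball 0 1) (ball 0 1)) {w z : ℂ} (hw : ‖w‖ < 1) (hz : ‖z‖ < 1) :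
    mobiusDist (f w) (f z) ≤ mobiusDist w z := by
  have hw' : ‖-w‖ < 1 := by simpa using hw
  have hfw : ‖f w‖ < 1 := mem_ball_zero_iff.mp (hm (mem_ball_zero_iff.mpr hw))
  have hM := mapsTo_diskMobius hw'
  -- Automorphisms on both sides move `w` and `f w` to `0`, which reduces the claim to the Schwarz
  -- lemma.
  have h := norm_le_norm_of_mapsTo_ball (R := 1)
    (f := diskMobius (f w) ∘ f ∘ diskMobius (-w)) (z := diskMobius w z)
    ((differentiableOn_diskMobius hfw).comp (hf.comp (differentiableOn_diskMobius hw') hM)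
      (hm.comp hM))
    (((mapsTo_diskMobius hfw).comp (hm.comp hM)).mono_right ball_subset_closedBall)
    (by simp [diskMobius_zero_right]) (norm_diskMobius_lt_one hw hz)
  simpa [mobiusDist_eq_norm_diskMobius, diskMobius_neg_diskMobius hw hz] using h

/-! ### Poincaré and Carathéodory distances. -/

theorem mobiusDist_mem_Ico {w z : ℂ} (hw : ‖w‖ < 1) (hz : ‖z‖ < 1) :
    mobiusDist w z ∈ Ico (0 : ℝ) 1 := by
  rw [mobiusDist_eq_norm_diskMobius]
  exact ⟨norm_nonneg _, norm_diskMobius_lt_one hw hz⟩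

theorem poincareDist_eq_artanh {w z : ℂ} (hw : ‖w‖ < 1) (hz : ‖z‖ < 1) :
    poincareDist w z = Real.artanh (mobiusDist w z) := by
  obtain ⟨h0, h1⟩ := mobiusDist_mem_Ico hw hz
  rw [Real.artanh_eq_half_log ⟨by linarith, h1.le⟩, poincareDist]

theorem tanh_poincareDist {w z : ℂ} (hw : ‖w‖ < 1) (hz : ‖z‖ < 1) :
    Real.tanh (poincareDist w z) = mobiusDist w z := by
  obtain ⟨h0, h1⟩ := mobiusDist_mem_Ico hw hz
  rw [poincareDist_eq_artanh hw hz, Real.tanh_artanh ⟨by linarith, h1⟩]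

theorem poincareDist_le_poincareDist_of_mapsTo {f : ℂ → ℂ}
    (hf : DifferentiableOn ℂ f (ball 0 1)) (hm : MapsTo f (ball 0 1) (ball 0 1)) {w z : ℂ}
    (hw : ‖w‖ < 1) (hz : ‖z‖ < 1) : poincareDist (f w) (f z) ≤ poincareDist w z := by
  have hfw : ‖f w‖ < 1 := mem_ball_zero_iff.mp (hm (mem_ball_zero_iff.mpr hw))
  have hfz : ‖f z‖ < 1 := mem_ball_zero_iff.mp (hm (mem_ball_zero_iff.mpr hz))
  rw [poincareDist_eq_artanh hw hz, poincareDist_eq_artanh hfw hfz]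
  have h1 := mobiusDist_mem_Ico hfw hfz
  exact Real.artanh_le_artanh (by linarith [h1.1]) (mobiusDist_mem_Ico hw hz).2
    (mobiusDist_le_mobiusDist_of_mapsTo hf hm hw hz)

/-- A competitor `F` factors as `(F ∘ g) ∘ f` with `F ∘ g` a self-map of the disk, which contracts
`p`; so `f` itself is extremal. -/
theorem caratheodoryDist_eq_poincareDist {D : Set ℂ} {f : ℂ → ℂ}
    (hf : IsBiholomorphic f D unitDisk) {w z : ℂ} (hw : w ∈ D) (hz : z ∈ D) :
    caratheodoryDist D w z = poincareDist (f w) (f z) := by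
  obtain ⟨⟨hfd, hfm⟩, g, ⟨hgd, hgm⟩, hgf, hfg⟩ := hf
  refine IsGreatest.csSup_eq ⟨⟨f, ⟨hfd, hfm⟩, rfl⟩, ?_⟩
  rintro _ ⟨F, ⟨hFd, hFm⟩, rfl⟩
  have hFg : DifferentiableOn ℂ (F ∘ g) (ball 0 1) := by
    rw [← unitDisk_eq_ball]; exact hFd.comp hgd hgm
  have hFgm : MapsTo (F ∘ g) (ball 0 1) (ball 0 1) := by
    rw [← unitDisk_eq_ball]; exact hFm.comp hgm
  simpa [hgf w hw, hgf z hz] using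
    poincareDist_le_poincareDist_of_mapsTo hFg hFgm (hfm hw) (hfm hz)

/-! ### Limits of holomorphic functions: Hurwitz and Montel. -/

/-- **Hurwitz's theorem**, local form: near an isolated zero of the limit, the functions of a
locally uniformly convergent family of holomorphic functions eventually have zeros. -/
theorem TendstoLocallyUniformlyOn.eventually_exists_eq_zero {ι : Type*} {l : Filter ι} [l.NeBot]
    {F : ι → ℂ → ℂ} {f : ℂ → ℂ} {U V : Set ℂ} (hU : IsOpen U)
    (hF : TendstoLocallyUniformlyOn F f l U) (hd : ∀ i, DifferentiableOn ℂ (F i) U)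
    {z₀ : ℂ} (hz₀ : z₀ ∈ U) (h0 : f z₀ = 0) (hne : ¬ ∀ᶠ z in 𝓝 z₀, f z = 0) (hV : V ∈ 𝓝 z₀) :
    ∀ᶠ i in l, ∃ z ∈ V, F i z = 0 := by
  have hfd : DifferentiableOn ℂ f U := hF.differentiableOn (.of_forall hd) hU
  have hfa : AnalyticAt ℂ f z₀ := hfd.analyticAt (hU.mem_nhds hz₀)
  have hpunct : ∀ᶠ z in 𝓝[≠] z₀, f z ≠ 0 :=
    hfa.eventually_eq_zero_or_eventually_ne_zero.resolve_left hne
  rw [eventually_nhdsWithin_iff] at hpunct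
  obtain ⟨r, hr, hrs⟩ := nhds_basis_closedBall.mem_iff.mp
    (inter_mem (inter_mem hV (hU.mem_nhds hz₀)) hpunct)
  have hne0 : ∀ z ∈ sphere z₀ r, f z ≠ 0 := fun z hz ↦
    (hrs (sphere_subset_closedBall hz)).2 (ne_of_mem_sphere hz hr.ne')
  have hUr : closedBall z₀ r ⊆ U := fun z hz ↦ (hrs hz).1.2
  obtain ⟨x, hx, hmin⟩ := (isCompact_sphere z₀ r).exists_isMinOn
    (NormedSpace.sphere_nonempty.mpr hr.le)
    (hfd.continuousOn.mono (sphere_subset_closedBall.trans hUr)).norm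
  have hm : 0 < ‖f x‖ := norm_pos_iff.mpr (hne0 x hx)
  have hunif := (tendstoLocallyUniformlyOn_iff_forall_isCompact hU).mp hF _ hUr
    (isCompact_closedBall z₀ r)
  filter_upwards [Metric.tendstoUniformlyOn_iff.mp hunif (‖f x‖ / 2) (by positivity)] with i hi
  -- Without zeros, the maximum principle for `1 / F i` propagates the lower bound `‖f x‖ / 2` from
  -- the circle to `z₀`, where `F i` is already smaller than that.
  by_contra! hcon
  have hnz : ∀ z ∈ closedBall z₀ r, F i z ≠ 0 := fun z hz ↦ hcon z (hrs hz).1.1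
  have hdc : DiffContOnCl ℂ (fun z ↦ (F i z)⁻¹) (ball z₀ r) :=
    ((((hd i).mono hUr).inv hnz)).diffContOnCl_ball subset_rfl
  have hb := norm_le_of_forall_mem_frontier_norm_le isBounded_ball hdc
    (C := (‖f x‖ / 2)⁻¹) (fun z hz ↦ by
      have hz' : z ∈ sphere z₀ r := frontier_ball_subset_sphere hz
      have h1 := hi z (sphere_subset_closedBall hz')
      have h2 : ‖f x‖ ≤ ‖f z‖ := hmin hz'
      rw [dist_eq_norm] at h1
      rw [norm_inv]
      gcongr
      linarith [norm_sub_norm_le (f z) (F i z)]) (subset_closure (mem_ball_self hr))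
  have h1 := hi z₀ (mem_closedBall_self hr.le)
  rw [h0, dist_zero_left] at h1
  rw [norm_inv] at hb
  have := (inv_le_inv₀ (norm_pos_iff.mpr (hnz z₀ (mem_closedBall_self hr.le)))
    (by positivity)).mp hb
  linarith

/-- **Montel's theorem** for ultrafilters: a uniformly bounded family of holomorphic functions
converges locally uniformly along every ultrafilter. -/
theorem Ultrafilter.exists_tendstoLocallyUniformlyOn {ι : Type*} (l : Ultrafilter ι)
    {F : ι → ℂ → ℂ} {U : Set ℂ} (hU : IsOpen U) (hd : ∀ i, DifferentiableOn ℂ (F i) U)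
    (hm : ∀ i, MapsTo (F i) U (ball 0 1)) :
    ∃ f : ℂ → ℂ, TendstoLocallyUniformlyOn F f l U := by
  have hpt : ∀ z : ℂ, ∃ y : ℂ, z ∈ U → Tendsto (fun i ↦ F i z) l (𝓝 y) := by
    intro z
    by_cases hz : z ∈ U
    · have hmem : closedBall (0 : ℂ) 1 ∈ l.map fun i ↦ F i z :=
        Ultrafilter.mem_map.mpr (univ_mem' fun i ↦ ball_subset_closedBall (hm i hz))
      obtain ⟨y, -, hy⟩ := (isCompact_closedBall (0 : ℂ) 1).ultrafilter_le_nhds' _ hmem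
      exact ⟨y, fun _ ↦ hy⟩
    · exact ⟨0, fun h ↦ absurd h hz⟩
  choose f hf using hpt
  refine ⟨f, Metric.tendstoLocallyUniformlyOn_iff.mpr fun ε hε x hx ↦ ?_⟩
  obtain ⟨r, hr, hrU⟩ := nhds_basis_ball.mem_iff.mp (hU.mem_nhds hx)
  -- Equicontinuity from the Schwarz lemma: values in the unit disk are within distance `2` of `F i
  -- x`.
  have hlip : ∀ i, ∀ y ∈ ball x r, dist (F i y) (F i x) ≤ 2 / r * dist y x := fun i y hy ↦
    dist_le_div_mul_dist_of_mapsTo_ball ((hd i).mono hrU) (fun z hz ↦ by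
      have h1 := hm i (hrU hz)
      have h2 := hm i hx
      rw [mem_ball_zero_iff] at h1 h2
      rw [mem_closedBall, dist_eq_norm]
      linarith [norm_sub_le (F i z) (F i x)]) hy
  have hlip' : ∀ y ∈ ball x r, dist (f y) (f x) ≤ 2 / r * dist y x := fun y hy ↦
    le_of_tendsto ((hf y (hrU hy)).dist (hf x hx)) (.of_forall fun i ↦ hlip i y hy)
  -- On this radius both Lipschitz errors are at most `ε / 4`, as is the pointwise error at `x`.
  have hδ : 0 < min r (ε * r / 8) := by positivity
  refine ⟨ball x (min r (ε * r / 8)), mem_nhdsWithin_of_mem_nhds (ball_mem_nhds x hδ), ?_⟩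
  filter_upwards [Metric.tendsto_nhds.mp (hf x hx) (ε / 4) (by positivity)] with i hi y hy
  have hy1 : y ∈ ball x r := ball_subset_ball (min_le_left _ _) hy
  have hy2 : 2 / r * dist y x ≤ ε / 4 := by
    have : dist y x ≤ ε * r / 8 := (mem_ball.mp hy).le.trans (min_le_right _ _)
    calc 2 / r * dist y x ≤ 2 / r * (ε * r / 8) := by gcongr
      _ = ε / 4 := by field_simp; ring
  have h1 := hlip i y hy1
  have h2 := hlip' y hy1
  have h3 := dist_triangle4 (f y) (f x) (F i x) (F i y)
  rw [dist_comm (f x), dist_comm (F i x) (F i y)] at h3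
  linarith

/-! ### The Riemann mapping theorem. -/

/-- Equality in the Schwarz lemma at one nonzero point makes `Φ` a nonzero multiple of the identity,
hence injective. This supplies the strict gain in the square-root trick. -/
theorem norm_lt_norm_of_mapsTo_ball_of_not_injOn {Φ : ℂ → ℂ}
    (hd : DifferentiableOn ℂ Φ (ball 0 1)) (hm : MapsTo Φ (ball 0 1) (ball 0 1)) (h0 : Φ 0 = 0)
    (hinj : ¬ InjOn Φ (ball 0 1)) {w : ℂ} (hw : ‖w‖ < 1) (hw0 : w ≠ 0) : ‖Φ w‖ < ‖w‖ := by
  have hmc : MapsTo Φ (ball 0 1) (closedBall 0 1) := hm.mono_right ball_subset_closedBall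
  refine lt_of_le_of_ne (norm_le_norm_of_mapsTo_ball hd hmc h0 hw) fun heq ↦ hinj ?_
  have hs : ‖dslope Φ 0 w‖ = 1 / 1 := by
    rw [dslope_of_ne _ hw0, slope_def_field, h0, sub_zero, sub_zero, norm_div, heq, div_one,
      div_self (norm_ne_zero_iff.mpr hw0)]
  have haff := affine_of_mapsTo_ball_of_norm_dslope_eq_div hd (by rwa [h0])
    (mem_ball_zero_iff.mpr hw) hs
  have hc : dslope Φ 0 w ≠ 0 := by rw [← norm_ne_zero_iff, hs]; norm_num
  intro x hx y hy hxy
  rw [haff hx, haff hy] at hxy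
  simpa [h0, hc] using hxy

/-- A continuous square root of a nonvanishing holomorphic function is holomorphic. -/
theorem hasDerivAt_of_sq_eq {s g : ℂ → ℂ} {z g' : ℂ} (hs : ContinuousAt s z)
    (hsg : ∀ x, s x ^ 2 = g x) (hg : HasDerivAt g g' z) (h0 : s z ≠ 0) :
    HasDerivAt s (g' / (2 * s z)) z := by
  rw [hasDerivAt_iff_tendsto_slope] at hg ⊢
  have hsum : Tendsto (fun x ↦ s x + s z) (𝓝 z) (𝓝 (2 * s z)) := by
    rw [two_mul]; exact hs.add tendsto_const_nhds
  have h2 : 2 * s z ≠ 0 := mul_ne_zero two_ne_zero h0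
  refine (hg.div (hsum.mono_left nhdsWithin_le_nhds) h2).congr' ?_
  filter_upwards [nhdsWithin_le_nhds (hsum.eventually_ne h2), self_mem_nhdsWithin] with x hx hxz
  rw [Pi.div_apply, div_eq_iff hx, slope_def_field, slope_def_field, ← hsg, ← hsg, div_mul_eq_mul_div]
  congr 1
  ring

/-- Injective holomorphic maps from `U` to the unit disk, without critical points and vanishing
at `a`. -/
structure IsDiskEmbedding (U : Set ℂ) (a : ℂ) (f : ℂ → ℂ) : Prop where
  mapsTo : MapsTo f U (ball 0 1)
  injOn : InjOn f U
  deriv_ne_zero : ∀ z ∈ U, deriv f z ≠ 0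
  map_base : f a = 0

namespace IsDiskEmbedding

variable {U : Set ℂ} {a : ℂ} {f : ℂ → ℂ}

/-- `deriv` takes the value `0` wherever a function is not differentiable, so the field
`deriv_ne_zero` already contains holomorphy. -/
theorem differentiableAt (hf : IsDiskEmbedding U a f) {z : ℂ} (hz : z ∈ U) :
    DifferentiableAt ℂ f z := differentiableAt_of_deriv_ne_zero (hf.deriv_ne_zero z hz)

theorem differentiableOn (hf : IsDiskEmbedding U a f) : DifferentiableOn ℂ f U :=
  fun _ hz ↦ (hf.differentiableAt hz).differentiableWithinAt

end IsDiskEmbedding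

theorem isDiskEmbedding_diskMobius_comp {U : Set ℂ} {s : ℂ → ℂ} (hm : MapsTo s U (ball 0 1))
    (hi : InjOn s U) (hd : ∀ z ∈ U, deriv s z ≠ 0) {a : ℂ} (ha : a ∈ U) :
    IsDiskEmbedding U a (diskMobius (s a) ∘ s) := by
  have hsa : ‖s a‖ < 1 := mem_ball_zero_iff.mp (hm ha)
  refine ⟨(mapsTo_diskMobius hsa).comp hm, (injOn_diskMobius hsa).comp hi hm, fun z hz ↦ ?_,
    by simp⟩
  have hsz : ‖s z‖ < 1 := mem_ball_zero_iff.mp (hm hz)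
  rw [((hasDerivAt_diskMobius hsa hsz).comp z
    (differentiableAt_of_deriv_ne_zero (hd z hz)).hasDerivAt).deriv]
  have h1 := one_sub_conj_mul_ne_zero hsa hsz
  have h2 := one_sub_conj_mul_ne_zero hsa hsa
  exact mul_ne_zero (div_ne_zero h2 (pow_ne_zero 2 h1)) (hd z hz)

/-- If a disk embedding of a simply connected domain is not onto, then there is another one which
is larger at any given point other than the base point. -/
theorem IsDiskEmbedding.exists_norm_lt {U : Set ℂ} {a p : ℂ} {f : ℂ → ℂ}
    (hf : IsDiskEmbedding U a f) (hUo : IsOpen U) (hUc : IsSimplyConnected U) (ha : a ∈ U)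
    (hp : p ∈ U) (hpa : p ≠ a) {v : ℂ} (hv : ‖v‖ < 1) (hvf : ∀ z ∈ U, f z ≠ v) :
    ∃ F, IsDiskEmbedding U a F ∧ ‖f p‖ < ‖F p‖ := by
  have hfn : ∀ z ∈ U, ‖f z‖ < 1 := fun z hz ↦ mem_ball_zero_iff.mp (hf.mapsTo hz)
  have hg0 : ∀ z ∈ U, diskMobius v (f z) ≠ 0 := fun z hz ↦
    div_ne_zero (sub_ne_zero.mpr (hvf z hz)) (one_sub_conj_mul_ne_zero hv (hfn z hz))
  have hgd : ∀ z ∈ U, HasDerivAt (diskMobius v ∘ f)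
      ((1 - conj v * v) / (1 - conj v * f z) ^ 2 * deriv f z) z := fun z hz ↦
    (hasDerivAt_diskMobius hv (hfn z hz)).comp z (hf.differentiableAt hz).hasDerivAt
  -- Koebe's trick: moving the omitted value `v` to `0` allows a square root, which is again
  -- injective into the disk.
  obtain ⟨s, hsc, hs⟩ := exists_continuousOn_pow_eq hUc hUo (g := diskMobius v ∘ f)
    (fun z hz ↦ (hgd z hz).continuousAt.continuousWithinAt)
    (by rintro ⟨z, hz, h⟩; exact hg0 z hz h) two_ne_zero
  have hs0 : ∀ z ∈ U, s z ≠ 0 := fun z hz h ↦ hg0 z hz (by simpa [h] using (hs z).symm)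
  have hsn : ∀ z ∈ U, ‖s z‖ < 1 := fun z hz ↦ by
    have h1 : ‖s z‖ ^ 2 < 1 := by
      rw [← norm_pow, hs]; exact norm_diskMobius_lt_one hv (hfn z hz)
    nlinarith [norm_nonneg (s z)]
  have hsd : ∀ z ∈ U, deriv s z ≠ 0 := fun z hz ↦ by
    rw [(hasDerivAt_of_sq_eq (hsc.continuousAt (hUo.mem_nhds hz)) hs (hgd z hz) (hs0 z hz)).deriv]
    exact div_ne_zero (mul_ne_zero (div_ne_zero (one_sub_conj_mul_ne_zero hv hv)
      (pow_ne_zero 2 (one_sub_conj_mul_ne_zero hv (hfn z hz)))) (hf.deriv_ne_zero z hz))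
      (mul_ne_zero two_ne_zero (hs0 z hz))
  have hrec : ∀ z ∈ U, diskMobius (-v) (s z ^ 2) = f z := fun z hz ↦ by
    rw [hs, Function.comp_apply, diskMobius_neg_diskMobius hv (hfn z hz)]
  have hsi : InjOn s U := fun z hz w hw h ↦ hf.injOn hz hw (by rw [← hrec z hz, ← hrec w hw, h])
  have hsm : MapsTo s U (ball 0 1) := fun z hz ↦ mem_ball_zero_iff.mpr (hsn z hz)
  have hF := isDiskEmbedding_diskMobius_comp hsm hsi hsd ha
  refine ⟨_, hF, ?_⟩
  have hv' : ‖-v‖ < 1 := by simpa using hv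
  have hsa := hsn a ha
  have hsa' : ‖-s a‖ < 1 := by simpa using hsa
  have hsq : MapsTo (fun z : ℂ ↦ z ^ 2) (ball 0 1) (ball 0 1) := fun z hz ↦ by
    rw [mem_ball_zero_iff] at *
    rw [norm_pow]
    exact pow_lt_one₀ (norm_nonneg _) hz two_ne_zero
  -- `Φ` undoes the construction, `f = Φ ∘ F`; it contains a squaring and so is not injective.
  set Φ : ℂ → ℂ := diskMobius (-v) ∘ (fun z ↦ z ^ 2) ∘ diskMobius (-s a) with hΦ
  have hΦf : ∀ z ∈ U, Φ (diskMobius (s a) (s z)) = f z := fun z hz ↦ by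
    simp only [hΦ, Function.comp_apply]
    rw [diskMobius_neg_diskMobius hsa (hsn z hz), hrec z hz]
  have hm1 := mapsTo_diskMobius hsa'
  have key := norm_lt_norm_of_mapsTo_ball_of_not_injOn (Φ := Φ)
    (w := diskMobius (s a) (s p))
    ((differentiableOn_diskMobius hv').comp
      ((differentiable_pow 2).differentiableOn.comp (differentiableOn_diskMobius hsa') hm1)
      (hsq.comp hm1))
    ((mapsTo_diskMobius hv').comp (hsq.comp hm1))
    (by simpa [hf.map_base] using hΦf a ha)
    -- The points `1/2` and `-1/2` have the same square, so their images under `diskMobius (s a)`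
    -- have the same value under `Φ`.
    (fun hinj ↦ by
      have e1 : ‖(1 / 2 : ℂ)‖ < 1 := by norm_num
      have e2 : ‖(-(1 / 2) : ℂ)‖ < 1 := by norm_num
      have h1 := hinj (mem_ball_zero_iff.mpr (norm_diskMobius_lt_one hsa e1))
        (mem_ball_zero_iff.mpr (norm_diskMobius_lt_one hsa e2)) (by
          simp only [hΦ, Function.comp_apply]
          rw [diskMobius_neg_diskMobius hsa e1, diskMobius_neg_diskMobius hsa e2, neg_sq])
      have h2 := injOn_diskMobius hsa (mem_ball_zero_iff.mpr e1) (mem_ball_zero_iff.mpr e2) h1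
      norm_num at h2)
    (norm_diskMobius_lt_one hsa (hsn p hp))
    (fun h ↦ hpa (hF.injOn hp ha (by simpa using h)))
  rwa [hΦf p hp] at key

/-- An extremal disk embedding exists. -/
theorem exists_isDiskEmbedding_forall_norm_le {U : Set ℂ} (hUo : IsOpen U)
    (hUc : IsPreconnected U) {a p : ℂ} (ha : a ∈ U) (hp : p ∈ U) (hpa : p ≠ a)
    (hne : ∃ f, IsDiskEmbedding U a f) :
    ∃ f, IsDiskEmbedding U a f ∧ ∀ F, IsDiskEmbedding U a F → ‖F p‖ ≤ ‖f p‖ := by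
  obtain ⟨f₀, hf₀⟩ := hne
  set S : Set ℝ := {t | ∃ f, IsDiskEmbedding U a f ∧ ‖f p‖ = t}
  have hbdd : BddAbove S := ⟨1, by
    rintro _ ⟨f, hf, rfl⟩
    exact (mem_ball_zero_iff.mp (hf.mapsTo hp)).le⟩
  obtain ⟨u, -, hu, huS⟩ := exists_seq_tendsto_sSup (S := S) ⟨_, f₀, hf₀, rfl⟩ hbdd
  choose F hF hFu using huS
  -- A free ultrafilter takes the place of passing to a subsequence.
  set l : Ultrafilter ℕ := hyperfilter ℕ
  have hd : ∀ i, DifferentiableOn ℂ (F i) U := fun i ↦ (hF i).differentiableOn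
  obtain ⟨f, hf⟩ := l.exists_tendstoLocallyUniformlyOn hUo hd fun i ↦ (hF i).mapsTo
  have hfd : DifferentiableOn ℂ f U := hf.differentiableOn (.of_forall hd) hUo
  have hfan : AnalyticOnNhd ℂ f U := hfd.analyticOnNhd hUo
  have hfp : ‖f p‖ = sSup S := by
    refine tendsto_nhds_unique (hf.tendsto_at hp).norm ?_
    simp_rw [hFu]
    exact hu.mono_left Nat.hyperfilter_le_atTop
  have hfa : f a = 0 := by
    refine tendsto_nhds_unique (hf.tendsto_at ha) ?_
    simp_rw [fun i ↦ (hF i).map_base]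
    exact tendsto_const_nhds
  have hle : ∀ F, IsDiskEmbedding U a F → ‖F p‖ ≤ ‖f p‖ := fun F hF ↦
    hfp ▸ le_csSup hbdd ⟨F, hF, rfl⟩
  have hfp0 : f p ≠ 0 := by
    intro h
    have := hle f₀ hf₀
    rw [h, norm_zero, norm_le_zero_iff, ← hf₀.map_base] at this
    exact hpa (hf₀.injOn hp ha this)
  have hnc : ∀ c, ¬ EqOn f (fun _ ↦ c) U := fun c h ↦
    hfp0 ((h hp).trans ((h ha).symm.trans hfa))
  have hnc' : ∀ c, ∀ z ∈ U, ¬ ∀ᶠ w in 𝓝 z, f w = c := fun c z hz h ↦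
    hnc c (hfan.eqOn_of_preconnected_of_eventuallyEq analyticOnNhd_const hUc hz h)
  have hinj : InjOn f U := by
    intro z₁ hz₁ z₂ hz₂ h12
    by_contra hne
    -- Hurwitz is applied near `z₂` to `F i - F i z₁`, on a neighbourhood avoiding `z₁`: a zero
    -- there contradicts injectivity of `F i`.
    have hG : TendstoLocallyUniformlyOn (fun i z ↦ F i z - F i z₁) (fun z ↦ f z - f z₁) l U := by
      refine Metric.tendstoLocallyUniformlyOn_iff.mpr fun ε hε x hx ↦ ?_
      obtain ⟨t, ht, hFt⟩ := Metric.tendstoLocallyUniformlyOn_iff.mp hf (ε / 2) (by positivity) x hx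
      refine ⟨t, ht, ?_⟩
      filter_upwards [hFt, Metric.tendsto_nhds.mp (hf.tendsto_at hz₁) (ε / 2) (by positivity)]
        with i h1 h2 y hy
      have h3 := dist_sub_sub_le (f y) (f z₁) (F i y) (F i z₁)
      rw [dist_comm (f z₁)] at h3
      linarith [h1 y hy]
    obtain ⟨i, z, hz, hzero⟩ := (hG.eventually_exists_eq_zero hUo
      (V := {z₁}ᶜ ∩ U) (fun i ↦ (hd i).sub_const _)
      hz₂ (by simp [h12]) (by simpa [sub_eq_zero] using hnc' (f z₁) z₂ hz₂)
      (inter_mem (isOpen_compl_singleton.mem_nhds (Ne.symm hne)) (hUo.mem_nhds hz₂))).exists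
    exact hz.1 ((hF i).injOn hz.2 hz₁ (sub_eq_zero.mp hzero))
  have hderiv : ∀ z ∈ U, deriv f z ≠ 0 := by
    intro z₀ hz₀ h0
    -- Hurwitz again, for the derivatives: a critical point of the limit would produce one of some
    -- `F i`.
    obtain ⟨i, z, hz, hzero⟩ := ((hf.deriv (.of_forall hd) hUo).eventually_exists_eq_zero hUo
      (V := U) (fun i ↦ (hd i).deriv hUo) hz₀ h0 (fun hev ↦ by
        obtain ⟨r, hr, hrs⟩ := nhds_basis_ball.mem_iff.mp (inter_mem hev (hUo.mem_nhds hz₀))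
        refine hnc' (f z₀) z₀ hz₀ ?_
        filter_upwards [ball_mem_nhds z₀ hr] with w hw
        exact isOpen_ball.is_const_of_deriv_eq_zero (convex_ball z₀ r).isPreconnected
          (hfd.mono fun x hx ↦ (hrs hx).2) (fun x hx ↦ (hrs hx).1) hw (mem_ball_self hr))
      (hUo.mem_nhds hz₀)).exists
    exact (hF i).deriv_ne_zero z hz hzero
  have hmaps : MapsTo f U (ball 0 1) := by
    have hle1 : ∀ z ∈ U, ‖f z‖ ≤ 1 := fun z hz ↦
      le_of_tendsto (hf.tendsto_at hz).norm (.of_forall fun i ↦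
        (mem_ball_zero_iff.mp ((hF i).mapsTo hz)).le)
    intro z hz
    rw [mem_ball_zero_iff]
    -- The limit a priori lands in the closed disk; reaching the circle would make it constant by
    -- the maximum principle.
    refine lt_of_le_of_ne (hle1 z hz) fun h ↦ ?_
    have hmax : IsMaxOn (norm ∘ f) U z := fun w hw ↦ by simpa [h] using hle1 w hw
    exact hnc _ (eqOn_of_isPreconnected_of_isMaxOn_norm hUc hUo hfd hz hmax)
  exact ⟨f, ⟨hmaps, hinj, hderiv, hfa⟩, hle⟩

/-- A holomorphic branch of `√(z - ζ)` on a simply connected domain omitting `ζ`. -/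
theorem exists_hasDerivAt_sqrt_sub {U : Set ℂ} (hUo : IsOpen U) (hUc : IsSimplyConnected U) {ζ : ℂ}
    (hζ : ζ ∉ U) :
    ∃ s : ℂ → ℂ, (∀ z, s z ^ 2 = z - ζ) ∧
      ∀ z ∈ U, s z ≠ 0 ∧ HasDerivAt s (1 / (2 * s z)) z := by
  have h0 : ∀ z ∈ U, z - ζ ≠ 0 := fun z hz h ↦ hζ (sub_eq_zero.mp h ▸ hz)
  obtain ⟨s, hsc, hs⟩ := exists_continuousOn_pow_eq hUc hUo (g := fun z ↦ z - ζ)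
    (by fun_prop) (by rintro ⟨z, hz, h⟩; exact h0 z hz h) two_ne_zero
  refine ⟨s, hs, fun z hz ↦ ?_⟩
  have hsz : s z ≠ 0 := fun h ↦ h0 z hz (by simpa [h] using (hs z).symm)
  exact ⟨hsz, hasDerivAt_of_sq_eq (hsc.continuousAt (hUo.mem_nhds hz)) hs
    ((hasDerivAt_id z).sub_const ζ) hsz⟩

/-- If `s z = -s w`, squaring gives `z = w`, hence `s z = 0`. Thus `s` and `-s` have no common
value, which drives both the embedding into the disk and the Koebe bound. -/
theorem add_ne_zero_of_sq_eq_sub {U : Set ℂ} {ζ : ℂ} {s : ℂ → ℂ} (hs : ∀ z, s z ^ 2 = z - ζ)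
    (h0 : ∀ z ∈ U, s z ≠ 0) {z w : ℂ} (hz : z ∈ U) : s z + s w ≠ 0 := by
  intro h
  have hsq : s z ^ 2 = s w ^ 2 := by rw [eq_neg_of_add_eq_zero_left h, neg_sq]
  rw [hs, hs, sub_left_inj] at hsq
  rw [← hsq] at h
  exact h0 z hz (by simpa using h)

theorem injective_of_sq_eq_sub {ζ : ℂ} {s : ℂ → ℂ} (hs : ∀ z, s z ^ 2 = z - ζ) :
    Function.Injective s := fun z w h ↦ by
  have h2 : s z ^ 2 = s w ^ 2 := by rw [h]
  rwa [hs, hs, sub_left_inj] at h2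

/-- A simply connected proper subdomain of the plane embeds into the unit disk. -/
theorem exists_isDiskEmbedding {U : Set ℂ} (hUo : IsOpen U) (hUc : IsSimplyConnected U)
    (hU : U ≠ univ) {a : ℂ} (ha : a ∈ U) : ∃ f, IsDiskEmbedding U a f := by
  obtain ⟨ζ, hζ⟩ := (ne_univ_iff_exists_notMem U).mp hU
  obtain ⟨s, hs, hsd⟩ := exists_hasDerivAt_sqrt_sub hUo hUc hζ
  have hst : HasStrictDerivAt s (deriv s a) a :=
    (DifferentiableOn.analyticAt (s := U)
      (fun z hz ↦ (hsd z hz).2.differentiableAt.differentiableWithinAt)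
      (hUo.mem_nhds ha)).hasStrictDerivAt
  have hd0 : ∀ z ∈ U, deriv s z ≠ 0 := fun z hz ↦ by
    rw [(hsd z hz).2.deriv]
    exact one_div_ne_zero (mul_ne_zero two_ne_zero (hsd z hz).1)
  have himg : s '' U ∈ 𝓝 (s a) := by
    rw [← hst.map_nhds_eq (hd0 a ha)]
    exact image_mem_map (hUo.mem_nhds ha)
  obtain ⟨ε, hε, hball⟩ := nhds_basis_closedBall.mem_iff.mp himg
  -- Since `s '' U` contains the disk of radius `ε` about `s a`, it misses the opposite disk about
  -- `-s a`; inverting about `-s a` then gives a bounded map.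
  have hfar : ∀ z ∈ U, ε < ‖s z + s a‖ := by
    intro z hz
    by_contra! hle
    obtain ⟨w, -, hw⟩ := hball (a := -s z) (by
      rwa [mem_closedBall, dist_eq_norm, ← norm_neg, neg_sub, sub_neg_eq_add, add_comm])
    exact add_ne_zero_of_sq_eq_sub hs (fun z hz ↦ (hsd z hz).1) hz (w := w) (by simp [hw])
  have hne : ∀ z ∈ U, s z + s a ≠ 0 := fun z hz ↦
    add_ne_zero_of_sq_eq_sub hs (fun z hz ↦ (hsd z hz).1) hz
  refine ⟨_, isDiskEmbedding_diskMobius_comp (s := fun z ↦ ε / (s z + s a)) ?_ ?_ ?_ ha⟩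
  · intro z hz
    rw [mem_ball_zero_iff, norm_div, norm_real, Real.norm_of_nonneg hε.le,
      div_lt_one (hε.trans (hfar z hz))]
    exact hfar z hz
  · intro z hz w hw h
    have hε' : (ε : ℂ) ≠ 0 := ofReal_ne_zero.mpr hε.ne'
    simp only [div_eq_mul_inv, mul_right_inj' hε', inv_inj, add_left_inj] at h
    exact injective_of_sq_eq_sub hs h
  · intro z hz
    have hε' : (ε : ℂ) ≠ 0 := ofReal_ne_zero.mpr hε.ne'
    rw [((hasDerivAt_const z (ε : ℂ)).fun_div ((hsd z hz).2.add_const (s a)) (hne z hz)).deriv]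
    simpa [hε', hne z hz] using (hsd z hz).1

/-- A holomorphic bijection without critical points is biholomorphic. -/
theorem isBiholomorphic_of_bijOn {U V : Set ℂ} {f : ℂ → ℂ} (hU : IsOpen U) (hf : BijOn f U V)
    (hd : ∀ z ∈ U, deriv f z ≠ 0) : IsBiholomorphic f U V := by
  have hdf : ∀ z ∈ U, DifferentiableAt ℂ f z := fun z hz ↦
    differentiableAt_of_deriv_ne_zero (hd z hz)
  have hinv := hf.invOn_invFunOn
  have hgm : MapsTo (Function.invFunOn f U) V U := hf.surjOn.mapsTo_invFunOn
  refine ⟨⟨fun z hz ↦ (hdf z hz).differentiableWithinAt, hf.mapsTo⟩, Function.invFunOn f U,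
    ⟨fun w hw ↦ ?_, hgm⟩, hinv.1, hinv.2⟩
  obtain ⟨z, hz, rfl⟩ := hf.surjOn hw
  have hst : HasStrictDerivAt f (deriv f z) z :=
    (DifferentiableOn.analyticAt (s := U) (fun z hz ↦ (hdf z hz).differentiableWithinAt)
      (hU.mem_nhds hz)).hasStrictDerivAt
  have hmap : map f (𝓝 z) = 𝓝 (f z) := hst.map_nhds_eq (hd z hz)
  have hgz : Function.invFunOn f U (f z) = z := hinv.1 hz
  have hUV : ∀ᶠ y in 𝓝 (f z), y ∈ V := by
    rw [← hmap, eventually_map]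
    filter_upwards [hU.mem_nhds hz] with x hx using hf.mapsTo hx
  have hcont : ContinuousAt (Function.invFunOn f U) (f z) := by
    rw [ContinuousAt, hgz, ← hmap, tendsto_map'_iff]
    refine tendsto_id.congr' ?_
    filter_upwards [hU.mem_nhds hz] with x hx
    exact (hinv.1 hx).symm
  refine (HasDerivAt.of_local_left_inverse hcont (f := f) (f' := deriv f z) ?_ (hd z hz)
    ?_).differentiableAt.differentiableWithinAt
  · rw [hgz]; exact (hdf z hz).hasDerivAt
  · filter_upwards [hUV] with y hy using hinv.2 hy

/-- The **Riemann mapping theorem**. -/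
theorem exists_isBiholomorphic_unitDisk {U : Set ℂ} (hUo : IsOpen U) (hUc : IsSimplyConnected U)
    (hU : U ≠ univ) {a : ℂ} (ha : a ∈ U) :
    ∃ f, IsBiholomorphic f U unitDisk ∧ f a = 0 := by
  obtain ⟨r, hr, hrU⟩ := nhds_basis_closedBall.mem_iff.mp (hUo.mem_nhds ha)
  have hp : a + r ∈ U := hrU (by simp [abs_of_pos hr])
  have hpa : a + r ≠ a := by simpa using hr.ne'
  obtain ⟨f, hf, hmax⟩ := exists_isDiskEmbedding_forall_norm_le hUo
    hUc.isPathConnected.isConnected.isPreconnected ha hp hpa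
    (exists_isDiskEmbedding hUo hUc hU ha)
  refine ⟨f, ?_, hf.map_base⟩
  rw [unitDisk_eq_ball]
  refine isBiholomorphic_of_bijOn hUo ⟨hf.mapsTo, hf.injOn, fun v hv ↦ ?_⟩ hf.deriv_ne_zero
  by_contra hcon
  obtain ⟨F, hF, hlt⟩ := hf.exists_norm_lt hUo hUc ha hp hpa (mem_ball_zero_iff.mp hv)
    fun z hz h ↦ hcon ⟨z, hz, h⟩
  exact hlt.not_ge (hmax F hF)

/-! ### Area for the metric `|dw| / |w|`. -/

theorem abs_det_smul_one (c : ℂ) :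
    |(c • (1 : ℂ →L[ℝ] ℂ)).det| = ‖c‖ ^ 2 := by
  have h : ((c • (1 : ℂ →L[ℝ] ℂ) : ℂ →L[ℝ] ℂ) : ℂ →ₗ[ℝ] ℂ) = LinearMap.mul ℝ ℂ c := by
    ext; simp
  have h2 : (c • (1 : ℂ →L[ℝ] ℂ)).det = normSq c := by
    rw [← Algebra.norm_complex_apply, Algebra.norm_apply]
    exact congrArg LinearMap.det h
  rw [h2, normSq_eq_norm_sq, abs_of_nonneg (sq_nonneg _)]

/-- The area for the conformal metric `|dw| / |w|`. -/
noncomputable def logArea (s : Set ℂ) : ENNReal :=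
  ∫⁻ w in s, ENNReal.ofReal ((‖w‖ ^ 2)⁻¹)

theorem logArea_image {φ φ' : ℂ → ℂ} {s : Set ℂ} (hs : MeasurableSet s)
    (hφ : ∀ z ∈ s, HasDerivAt φ (φ' z) z) (hinj : InjOn φ s) :
    logArea (φ '' s) = ∫⁻ z in s, ENNReal.ofReal (‖φ' z / φ z‖ ^ 2) := by
  rw [logArea, lintegral_image_eq_lintegral_abs_det_fderiv_mul volume hs
    (fun z hz ↦ (hφ z hz).complexToReal_fderiv.hasFDerivWithinAt) hinj]
  refine lintegral_congr fun z ↦ ?_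
  rw [abs_det_smul_one, ← ENNReal.ofReal_mul (by positivity), norm_div, div_pow, div_eq_mul_inv]

/-- Inversion is an isometry of `|dw| / |w|`: its logarithmic derivative `-1 / z` has the same
modulus as `1 / z`. -/
theorem logArea_image_inv {s : Set ℂ} (hs : MeasurableSet s) (h0 : (0 : ℂ) ∉ s) :
    logArea ((fun z ↦ z⁻¹) '' s) = logArea s := by
  rw [logArea_image (φ' := fun z ↦ -(z ^ 2)⁻¹) hs
    (fun z hz ↦ hasDerivAt_inv (ne_of_mem_of_not_mem hz h0)) inv_injective.injOn]
  refine setLIntegral_congr_fun hs fun z hz ↦ ?_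
  have hz0 : z ≠ 0 := ne_of_mem_of_not_mem hz h0
  have : -(z ^ 2)⁻¹ / z⁻¹ = -z⁻¹ := by field_simp
  simp only [this, norm_neg, norm_inv, inv_pow]

theorem logArea_mono {s t : Set ℂ} (h : s ⊆ t) : logArea s ≤ logArea t :=
  lintegral_mono_set h

theorem logArea_union {s t : Set ℂ} (ht : MeasurableSet t) (h : Disjoint s t) :
    logArea (s ∪ t) = logArea s + logArea t :=
  lintegral_union ht h

/-- The closed annulus around the origin with radii `r` and `R`. -/
def closedAnnulus (r R : ℝ) : Set ℂ := {z | r ≤ ‖z‖ ∧ ‖z‖ ≤ R}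

/-- The rectangle mapped bijectively onto `closedAnnulus r R` by the exponential. -/
noncomputable def logRectangle (r R : ℝ) : Set ℂ :=
  Icc (Real.log r) (Real.log R) ×ℂ Ioc (-Real.pi) Real.pi

theorem measurableSet_logRectangle (r R : ℝ) : MeasurableSet (logRectangle r R) :=
  (measurable_re measurableSet_Icc).inter (measurable_im measurableSet_Ioc)

theorem injOn_exp_logRectangle (r R : ℝ) : InjOn exp (logRectangle r R) := fun _ hx _ hy h ↦
  exp_inj_of_neg_pi_lt_of_le_pi hx.2.1 hx.2.2 hy.2.1 hy.2.2 h

theorem exp_image_logRectangle {r R : ℝ} (hr : 0 < r) (hR : 0 < R) :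
    exp '' logRectangle r R = closedAnnulus r R := by
  ext z
  constructor
  · rintro ⟨τ, hτ, rfl⟩
    have hre : Real.log r ≤ τ.re ∧ τ.re ≤ Real.log R := hτ.1
    refine ⟨?_, ?_⟩
    · rw [norm_exp, ← Real.log_le_iff_le_exp hr]
      exact hre.1
    · rw [norm_exp, ← Real.le_log_iff_exp_le hR]
      exact hre.2
  · rintro ⟨h1, h2⟩
    have hz : 0 < ‖z‖ := hr.trans_le h1
    refine ⟨log z, ⟨?_, ?_⟩, exp_log (norm_pos_iff.mp hz)⟩
    · rw [mem_preimage, log_re]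
      exact ⟨Real.log_le_log hr h1, Real.log_le_log hz h2⟩
    · rw [mem_preimage, log_im]
      exact ⟨neg_pi_lt_arg z, arg_le_pi z⟩

theorem volume_logRectangle (r R : ℝ) :
    volume (logRectangle r R) =
      ENNReal.ofReal (Real.log R - Real.log r) * ENNReal.ofReal (2 * Real.pi) := by
  have h : logRectangle r R = measurableEquivRealProd ⁻¹'
      (Icc (Real.log r) (Real.log R) ×ˢ Ioc (-Real.pi) Real.pi) := rfl
  rw [h, volume_preserving_equiv_real_prod.measure_preimage_equiv, Measure.volume_eq_prod,
    Measure.prod_prod, Real.volume_Icc, Real.volume_Ioc]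
  congr 2
  ring

theorem logArea_closedAnnulus {r R : ℝ} (hr : 0 < r) (hR : 0 < R) :
    logArea (closedAnnulus r R) =
      ENNReal.ofReal (Real.log R - Real.log r) * ENNReal.ofReal (2 * Real.pi) := by
  rw [← exp_image_logRectangle hr hR, logArea_image (measurableSet_logRectangle r R)
    (fun z _ ↦ hasDerivAt_exp z) (injOn_exp_logRectangle r R), ← volume_logRectangle]
  simp [exp_ne_zero]

theorem integral_comp_circleMap_neg_pi_pi {q : ℂ → ℂ} {R : ℝ} (hR : 0 ≤ R)
    (hq : DifferentiableOn ℂ q (closedBall 0 R)) :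
    ∫ θ in Ioc (-Real.pi) Real.pi, q (circleMap 0 R θ) = 2 * Real.pi * q 0 := by
  have h1 : Real.circleAverage q 0 R = q 0 :=
    DiffContOnCl.circleAverage (by rw [abs_of_nonneg hR]; exact hq.diffContOnCl_ball subset_rfl)
  rw [Real.circleAverage_eq_integral_add (-Real.pi)] at h1
  have h2 := intervalIntegral.integral_comp_add_right (a := 0) (b := 2 * Real.pi)
    (fun θ ↦ q (circleMap 0 R θ)) (-Real.pi)
  rw [h2] at h1
  rw [← intervalIntegral.integral_of_le (by linarith [Real.pi_pos]), ← h1, real_smul]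
  have hpi : (Real.pi : ℂ) ≠ 0 := ofReal_ne_zero.mpr Real.pi_ne_zero
  push_cast
  rw [show 2 * Real.pi + -Real.pi = Real.pi by ring, zero_add]
  field_simp

/-- Each vertical segment of the rectangle is wrapped once around a circle by `exp`, so the mean
value property evaluates the inner integral in Fubini's theorem. -/
theorem integral_comp_exp_logRectangle {q : ℂ → ℂ} {r R : ℝ} (hr : 0 < r) (hrR : r ≤ R)
    (hq : DifferentiableOn ℂ q (closedBall 0 R)) :
    IntegrableOn (fun τ ↦ q (exp τ)) (logRectangle r R) ∧
    IntegrableOn (fun τ ↦ ‖q (exp τ)‖ ^ 2) (logRectangle r R) ∧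
    ∫ τ in logRectangle r R, q (exp τ) =
      (Real.log R - Real.log r : ℝ) * (2 * Real.pi * q 0) := by
  have hR : 0 < R := hr.trans_le hrR
  set K : Set ℂ := Icc (Real.log r) (Real.log R) ×ℂ Icc (-Real.pi) Real.pi
  have hK : IsCompact K := isCompact_Icc.reProdIm isCompact_Icc
  have hsub : logRectangle r R ⊆ K := fun z hz ↦ ⟨hz.1, Ioc_subset_Icc_self hz.2⟩
  have hKR : MapsTo exp K (closedBall 0 R) := fun z hz ↦ by
    rw [mem_closedBall_zero_iff, norm_exp, ← Real.le_log_iff_exp_le hR]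
    exact hz.1.2
  have hc : ContinuousOn (fun τ ↦ q (exp τ)) K :=
    hq.continuousOn.comp continuous_exp.continuousOn hKR
  have hint : IntegrableOn (fun τ ↦ q (exp τ)) (logRectangle r R) :=
    (hc.integrableOn_compact hK).mono_set hsub
  refine ⟨hint, ((hc.norm.pow 2).integrableOn_compact hK).mono_set hsub, ?_⟩
  have hmp := volume_preserving_equiv_real_prod.symm
  have hpre : measurableEquivRealProd.symm ⁻¹' logRectangle r R =
      Icc (Real.log r) (Real.log R) ×ˢ Ioc (-Real.pi) Real.pi := rfl
  rw [← hmp.setIntegral_preimage_emb measurableEquivRealProd.symm.measurableEmbedding, hpre,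
    Measure.volume_eq_prod, setIntegral_prod]
  · have hin : ∀ t ∈ Icc (Real.log r) (Real.log R),
        ∫ θ in Ioc (-Real.pi) Real.pi, q (exp (measurableEquivRealProd.symm (t, θ))) =
          2 * Real.pi * q 0 := by
      intro t ht
      have ht' : Real.exp t ≤ R := (Real.le_log_iff_exp_le hR).mp ht.2
      rw [← integral_comp_circleMap_neg_pi_pi (Real.exp_pos t).le
        (hq.mono (closedBall_subset_closedBall ht'))]
      refine integral_congr_ae (.of_forall fun θ ↦ ?_)
      simp only [measurableEquivRealProd_symm_apply, circleMap, zero_add, ofReal_exp, ← exp_add]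
      congr 2
      apply Complex.ext <;> simp
    rw [setIntegral_congr_fun measurableSet_Icc hin, setIntegral_const, Real.volume_real_Icc_of_le
      (Real.log_le_log hr hrR), real_smul]
  · have := (hmp.integrableOn_comp_preimage measurableEquivRealProd.symm.measurableEmbedding).mpr
      hint
    rwa [hpre] at this

/-! ### The derivative bound for univalent Bieberbach–Eilenberg functions. -/

/-- In the coordinate `τ = log w` the area is the integral of `|q|²`, where `q(w) = w b'(w) / b(w)`
is holomorphic with `q(0) = 1`. The mean value property gives the integral of `Re q`, and `|q|² ≥ 2
Re q - 1` finishes. -/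
theorem le_logArea_image {b : ℂ → ℂ} (hb : DifferentiableOn ℂ b (ball 0 1))
    (hinj : InjOn b (ball 0 1)) (h0 : b 0 = 0) (hd0 : deriv b 0 ≠ 0) {r R : ℝ} (hr : 0 < r)
    (hrR : r ≤ R) (hR : R < 1) :
    ENNReal.ofReal ((Real.log R - Real.log r) * (2 * Real.pi)) ≤
      logArea (b '' closedAnnulus r R) := by
  have hball : ball (0 : ℂ) 1 ∈ 𝓝 0 := ball_mem_nhds 0 one_pos
  have hk : DifferentiableOn ℂ (dslope b 0) (ball 0 1) := (differentiableOn_dslope hball).mpr hb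
  have hk0 : ∀ z ∈ ball (0 : ℂ) 1, dslope b 0 z ≠ 0 := by
    intro z hz h
    rcases eq_or_ne z 0 with rfl | hz0
    · exact hd0 (by rwa [dslope_same] at h)
    · rw [dslope_of_ne _ hz0, slope_def_field, h0, sub_zero, sub_zero, div_eq_zero_iff] at h
      rcases h with h | h
      · exact hz0 (hinj hz (mem_of_mem_nhds hball) (h.trans h0.symm))
      · exact hz0 h
  set q : ℂ → ℂ := fun z ↦ deriv b z / dslope b 0 z
  have hq : DifferentiableOn ℂ q (closedBall 0 R) :=
    ((hb.deriv isOpen_ball).div hk hk0).mono (closedBall_subset_ball hR)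
  have hq0 : q 0 = 1 := by simp [q, hd0]
  obtain ⟨hi1, hi2, heq⟩ := integral_comp_exp_logRectangle hr hrR hq
  have hexp : ∀ τ ∈ logRectangle r R, exp τ ∈ ball (0 : ℂ) 1 := fun τ hτ ↦ by
    rw [mem_ball_zero_iff, norm_exp]
    exact ((Real.le_log_iff_exp_le (hr.trans_le hrR)).mp hτ.1.2).trans_lt hR
  rw [← exp_image_logRectangle hr (hr.trans_le hrR), ← image_comp, logArea_image (φ' := fun τ ↦ deriv b (exp τ) * exp τ)
    (measurableSet_logRectangle r R) (fun τ hτ ↦ ((hb.differentiableAt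
      (isOpen_ball.mem_nhds (hexp τ hτ))).hasDerivAt).comp τ (hasDerivAt_exp τ))
    (hinj.comp (injOn_exp_logRectangle r R) hexp)]
  have hcongr : ∫⁻ τ in logRectangle r R,
      ENNReal.ofReal (‖deriv b (exp τ) * exp τ / (b ∘ exp) τ‖ ^ 2) =
      ∫⁻ τ in logRectangle r R, ENNReal.ofReal (‖q (exp τ)‖ ^ 2) := by
    refine setLIntegral_congr_fun (measurableSet_logRectangle r R) fun τ _ ↦ ?_
    simp only [q, Function.comp_apply, dslope_of_ne _ (exp_ne_zero τ), slope_def_field, h0, sub_zero,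
      div_div_eq_mul_div]
  rw [hcongr, ← ofReal_integral_eq_lintegral_ofReal hi2 (.of_forall fun _ ↦ by positivity)]
  apply ENNReal.ofReal_le_ofReal
  have hre : ∫ τ in logRectangle r R, (q (exp τ)).re =
      (Real.log R - Real.log r) * (2 * Real.pi) := by
    have := integral_re hi1
    simp only [RCLike.re_eq_complex_re] at this
    rw [this, heq, hq0, re_ofReal_mul]
    simp
  have hvol : volume.real (logRectangle r R) = (Real.log R - Real.log r) * (2 * Real.pi) := by
    have : 0 ≤ Real.log R - Real.log r := sub_nonneg.mpr (Real.log_le_log hr hrR)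
    rw [Measure.real, volume_logRectangle, ENNReal.toReal_mul, ENNReal.toReal_ofReal this,
      ENNReal.toReal_ofReal (by positivity)]
  have hi1' : IntegrableOn (fun τ ↦ (q (exp τ)).re) (logRectangle r R) := hi1.re
  have hi0 : IntegrableOn (fun _ ↦ (1 : ℝ)) (logRectangle r R) := by
    refine integrableOn_const (by rw [volume_logRectangle]; finiteness)
  calc (Real.log R - Real.log r) * (2 * Real.pi)
      = ∫ τ in logRectangle r R, (2 * (q (exp τ)).re - 1) := by
        rw [integral_sub (hi1'.const_mul 2) hi0, integral_const_mul, hre,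
          setIntegral_const, hvol, smul_eq_mul]
        ring
    _ ≤ _ := by
        refine integral_mono ((hi1'.const_mul 2).sub hi0) hi2 fun τ ↦ ?_
        have h1 := re_le_norm (q (exp τ))
        nlinarith [sq_nonneg (‖q (exp τ)‖ - 1)]

/-- A map with `a ≤ |b|` on a circle around its zero covers the disk of radius `a`. -/
theorem ball_subset_image_ball {b : ℂ → ℂ} {r a : ℝ} (hr : 0 < r)
    (hb : DifferentiableOn ℂ b (closedBall 0 r)) (hinj : InjOn b (ball 0 r)) (h0 : b 0 = 0)
    (ha : ∀ z ∈ sphere (0 : ℂ) r, a ≤ ‖b z‖) : ball 0 a ⊆ b '' ball 0 r := by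
  rcases le_or_gt a 0 with ha0 | ha0
  · simp [ball_eq_empty.mpr ha0]
  have hopen : IsOpen (b '' ball 0 r) := by
    have han : AnalyticOnNhd ℂ b (ball 0 r) :=
      (hb.mono ball_subset_closedBall).analyticOnNhd isOpen_ball
    rcases han.is_constant_or_isOpen (convex_ball 0 r).isPreconnected with ⟨w, hw⟩ | h
    · exfalso
      have hmem : ((r / 2 : ℝ) : ℂ) ∈ ball (0 : ℂ) r := by
        rw [mem_ball_zero_iff, norm_real, Real.norm_of_nonneg (by positivity)]; linarith
      have := hinj hmem (mem_ball_self hr) ((hw _ hmem).trans (hw 0 (mem_ball_self hr)).symm)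
      rw [ofReal_eq_zero] at this
      linarith
    · exact h _ subset_rfl isOpen_ball
  have hclosed : IsClosed (b '' closedBall 0 r) :=
    ((isCompact_closedBall 0 r).image_of_continuousOn hb.continuousOn).isClosed
  -- The image is open, and relatively closed in `ball 0 a`: limit points come from the closed disk,
  -- and the bounding circle is sent to norms at least `a`.
  refine (convex_ball (0 : ℂ) a).isPreconnected.subset_of_closure_inter_subset hopen
    ⟨0, mem_ball_self ha0, 0, mem_ball_self hr, h0⟩ ?_
  rintro w ⟨hw, hwa⟩
  obtain ⟨z, hz, rfl⟩ := closure_minimal (image_mono ball_subset_closedBall) hclosed hw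
  refine ⟨z, ?_, rfl⟩
  rw [mem_closedBall_zero_iff] at hz
  rw [mem_ball_zero_iff] at hwa ⊢
  refine lt_of_le_of_ne hz fun h ↦ hwa.not_ge (ha z (by simpa using h))

/-- Univalent **Bieberbach–Eilenberg functions** have derivative at most one at the origin. -/
theorem norm_deriv_le_one_of_mul_ne_one {b : ℂ → ℂ} (hb : DifferentiableOn ℂ b (ball 0 1))
    (hinj : InjOn b (ball 0 1)) (h0 : b 0 = 0)
    (hBE : ∀ z ∈ ball (0 : ℂ) 1, ∀ w ∈ ball (0 : ℂ) 1, b z * b w ≠ 1) : ‖deriv b 0‖ ≤ 1 := by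
  by_contra! hgt
  obtain ⟨a, ha1, ha⟩ := exists_between hgt
  have ha0 : 0 < a := one_pos.trans ha1
  have hd0 : deriv b 0 ≠ 0 := norm_pos_iff.mp (one_pos.trans hgt)
  have hev : ∀ᶠ z in 𝓝 (0 : ℂ), a * ‖z‖ ≤ ‖b z‖ := by
    have hcont : ContinuousAt (dslope b 0) 0 :=
      continuousAt_dslope_same.mpr (hb.differentiableAt (ball_mem_nhds 0 one_pos))
    filter_upwards [hcont.norm.eventually_const_lt (by simpa using ha)] with z hz
    rcases eq_or_ne z 0 with rfl | hz0
    · simp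
    · rw [dslope_of_ne _ hz0, slope_def_field, h0, sub_zero, sub_zero, norm_div,
        lt_div_iff₀ (norm_pos_iff.mpr hz0)] at hz
      exact hz.le
  obtain ⟨r₀, hr₀, hball⟩ := nhds_basis_closedBall.mem_iff.mp hev
  -- The inner radius satisfies `a * r < 1`, so that the target annulus makes sense; the outer
  -- radius below satisfies `1 / a < R < 1`, so `a * R > 1`.
  obtain ⟨r, hr, hrlt⟩ := exists_between (lt_min hr₀ (one_div_pos.mpr ha0))
  have hr0 : r < r₀ := hrlt.trans_le (min_le_left _ _)
  have hra : r < 1 / a := hrlt.trans_le (min_le_right _ _)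
  obtain ⟨R, haR, hR⟩ := exists_between ((div_lt_one ha0).mpr ha1)
  have hrR : r ≤ R := (hra.trans haR).le
  have hr1 : r < 1 := hrR.trans_lt hR
  have hcover : ball 0 (a * r) ⊆ b '' ball 0 r :=
    ball_subset_image_ball hr (hb.mono (closedBall_subset_ball hr1))
      (hinj.mono (ball_subset_ball hr1.le)) h0 fun z hz ↦ by
        have hz' : ‖z‖ = r := by simpa using hz
        simpa [hz'] using hball (mem_closedBall_zero_iff.mpr (hz'.le.trans hr0.le))
  have har : 0 < a * r := mul_pos ha0 hr
  set A := b '' closedAnnulus r R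
  have hann : closedAnnulus r R ⊆ ball 0 1 := fun z hz ↦ mem_ball_zero_iff.mpr (hz.2.trans_lt hR)
  have hannm : MeasurableSet (closedAnnulus r R) :=
    (isClosed_le continuous_const continuous_norm).measurableSet.inter
      (isClosed_le continuous_norm continuous_const).measurableSet
  have hAm : MeasurableSet A :=
    hannm.image_of_continuousOn_injOn (hb.continuousOn.mono hann) (hinj.mono hann)
  have hAlow : ∀ w ∈ A, a * r ≤ ‖w‖ := by
    rintro _ ⟨z, hz, rfl⟩
    by_contra! hlt
    obtain ⟨z', hz', heq⟩ := hcover (mem_ball_zero_iff.mpr hlt)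
    have := hinj (ball_subset_ball hr1.le hz') (hann hz) heq
    rw [this, mem_ball_zero_iff] at hz'
    exact hz'.not_ge hz.1
  have hA0 : (0 : ℂ) ∉ A := fun h ↦ by simpa using har.trans_le (hAlow 0 h)
  have hAup : ∀ w ∈ A, ‖w‖ ≤ (a * r)⁻¹ := by
    rintro _ ⟨z, hz, rfl⟩
    by_contra! hlt
    have hbz : b z ≠ 0 := fun h ↦ hA0 ⟨z, hz, h⟩
    -- If `b z` were too large, its inverse would lie in the covered disk and be a value of `b`,
    -- against `hBE`.
    obtain ⟨z', hz', heq⟩ := hcover (a := (b z)⁻¹) (by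
      rw [mem_ball_zero_iff, norm_inv]
      exact inv_lt_of_inv_lt₀ har hlt)
    exact hBE z (hann hz) z' (ball_subset_ball hr1.le hz') (by rw [heq, mul_inv_cancel₀ hbz])
  have hdisj : Disjoint A ((fun z ↦ z⁻¹) '' A) := by
    rw [Set.disjoint_left]
    rintro _ ⟨z, hz, rfl⟩ ⟨_, ⟨z', hz', rfl⟩, heq⟩
    have hbz : b z' ≠ 0 := fun h ↦ hA0 ⟨z', hz', h⟩
    exact hBE z (hann hz) z' (hann hz') (by rw [← heq, inv_mul_cancel₀ hbz])
  have hinvm : MeasurableSet ((fun z : ℂ ↦ z⁻¹) '' A) := by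
    rw [image_inv_eq_inv]; exact hAm.inv
  have hsub : A ∪ (fun z ↦ z⁻¹) '' A ⊆ closedAnnulus (a * r) (a * r)⁻¹ := by
    rintro w (hw | ⟨v, hv, rfl⟩)
    · exact ⟨hAlow w hw, hAup w hw⟩
    · have hv0 : 0 < ‖v‖ := har.trans_le (hAlow v hv)
      refine ⟨?_, ?_⟩
      · rw [norm_inv]
        exact (le_inv_comm₀ hv0 har).mp (hAup v hv)
      · rw [norm_inv]
        exact inv_anti₀ har (hAlow v hv)
  have hle := logArea_mono hsub
  rw [logArea_union hinvm hdisj, logArea_image_inv hAm hA0, logArea_closedAnnulus har (inv_pos.mpr har)] at hle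
  have hlow := le_logArea_image hb hinj h0 hd0 hr hrR hR
  have hlog : Real.log r ≤ Real.log R := Real.log_le_log hr hrR
  have hfin := (add_le_add hlow hlow).trans hle
  have hpi := Real.pi_pos
  have har1 : a * r < 1 := by rwa [lt_div_iff₀ ha0, mul_comm] at hra
  have hlogar : Real.log (a * r) < 0 := Real.log_neg har har1
  rw [← ENNReal.ofReal_add (mul_nonneg (by linarith) (by positivity))
    (mul_nonneg (by linarith) (by positivity)), Real.log_inv,
    ← ENNReal.ofReal_mul (by linarith), ENNReal.ofReal_le_ofReal_iff
    (mul_nonneg (by linarith) (by positivity))] at hfin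
  -- Twice `2π log (R / r)` is at most `2π · (-2 log (a r))`; the radius `r` cancels and leaves `a R
  -- ≤ 1`.
  have h3 : Real.log R - Real.log r ≤ -Real.log (a * r) := by nlinarith
  rw [Real.log_mul ha0.ne' hr.ne'] at h3
  have h4 : 0 < Real.log (a * R) := Real.log_pos (by
    rwa [div_lt_iff₀ ha0, mul_comm] at haR)
  rw [Real.log_mul ha0.ne' (hr.trans_le hrR).ne'] at h4
  linarith

/-! ### Lower bounds for the hyperbolic density. -/

/-- The inverse of a Riemann map, precomposed with a disk automorphism sending `0` to the image of
`x`. -/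
theorem IsBiholomorphic.exists_parametrization {D : Set ℂ} {f : ℂ → ℂ} (hD : IsOpen D)
    (hf : IsBiholomorphic f D unitDisk) {x : ℂ} (hx : x ∈ D) :
    ∃ φ : ℂ → ℂ, DifferentiableOn ℂ φ (ball 0 1) ∧ MapsTo φ (ball 0 1) D ∧ InjOn φ (ball 0 1) ∧
      φ 0 = x ∧ ‖deriv f x‖ * ‖deriv φ 0‖ = 1 - ‖f x‖ ^ 2 := by
  obtain ⟨⟨hfd, hfm⟩, g, ⟨hgd, hgm⟩, hgf, hfg⟩ := hf
  rw [unitDisk_eq_ball] at *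
  have hfx : ‖f x‖ < 1 := mem_ball_zero_iff.mp (hfm hx)
  have hfx' : ‖-f x‖ < 1 := by simpa using hfx
  have hM := mapsTo_diskMobius hfx'
  have h0 : (0 : ℂ) ∈ ball (0 : ℂ) 1 := mem_ball_self one_pos
  have hφd : DifferentiableOn ℂ (g ∘ diskMobius (-f x)) (ball 0 1) :=
    hgd.comp (differentiableOn_diskMobius hfx') hM
  have hφ0 : (g ∘ diskMobius (-f x)) 0 = x := by simp [diskMobius_zero_right, hgf x hx]
  have hleft : LeftInvOn (diskMobius (f x) ∘ f) (g ∘ diskMobius (-f x)) (ball 0 1) := fun t ht ↦ by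
    simp only [Function.comp_apply]
    rw [hfg _ (hM ht), diskMobius_diskMobius_neg hfx (mem_ball_zero_iff.mp ht)]
  refine ⟨g ∘ diskMobius (-f x), hφd, hgm.comp hM, hleft.injOn, hφ0, ?_⟩
  have hd1 : HasDerivAt (g ∘ diskMobius (-f x)) (deriv (g ∘ diskMobius (-f x)) 0) 0 :=
    (hφd.differentiableAt (isOpen_ball.mem_nhds h0)).hasDerivAt
  have hd2 : HasDerivAt (diskMobius (f x) ∘ f) (1 / (1 - ‖f x‖ ^ 2 : ℝ) * deriv f x)
      ((g ∘ diskMobius (-f x)) 0) := by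
    rw [hφ0]
    exact (hasDerivAt_diskMobius_self hfx).comp x
      (hfd.differentiableAt (hD.mem_nhds hx)).hasDerivAt
  have hd3 := (hd2.comp 0 hd1).unique ((hasDerivAt_id (0 : ℂ)).congr_of_eventuallyEq
    (eventually_of_mem (isOpen_ball.mem_nhds h0) fun t ht ↦ hleft ht))
  have hpos : 0 < 1 - ‖f x‖ ^ 2 := by nlinarith [norm_nonneg (f x)]
  have hnorm := congrArg norm hd3
  rw [norm_mul, norm_mul, norm_div, norm_one, norm_real, Real.norm_of_nonneg hpos.le] at hnorm
  field_simp at hnorm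
  linarith

/-- The chain rule turns a derivative bound for `h ∘ φ` at `0` into a density bound; `c` will be `1
- ‖f x‖ ^ 2`. -/
theorem mul_le_norm_deriv_of_norm_deriv_comp_le_one {φ h : ℂ → ℂ} {x h' f' : ℂ} {c : ℝ}
    (hφ : DifferentiableAt ℂ φ 0) (hφ0 : φ 0 = x) (hc : ‖f'‖ * ‖deriv φ 0‖ = c)
    (hh : HasDerivAt h h' x) (hle : ‖deriv (h ∘ φ) 0‖ ≤ 1) : ‖h'‖ * c ≤ ‖f'‖ := by
  subst hφ0
  rw [(hh.comp 0 hφ.hasDerivAt).deriv, norm_mul] at hle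
  calc ‖h'‖ * c = ‖f'‖ * (‖h'‖ * ‖deriv φ 0‖) := by rw [← hc]; ring
    _ ≤ ‖f'‖ * 1 := by gcongr
    _ = ‖f'‖ := mul_one _

/-- The **Koebe quarter theorem**, as a lower bound for the hyperbolic density of a simply
connected domain. -/
theorem IsBiholomorphic.one_div_four_mul_le_norm_deriv {D : Set ℂ} {f : ℂ → ℂ} (hD : IsOpen D)
    (hDc : IsSimplyConnected D) (hf : IsBiholomorphic f D unitDisk) {x ζ : ℂ} (hx : x ∈ D)
    (hζ : ζ ∉ D) : 1 / 4 / ‖x - ζ‖ * (1 - ‖f x‖ ^ 2) ≤ ‖deriv f x‖ := by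
  obtain ⟨φ, hφd, hφm, hφi, hφ0, hφ⟩ := hf.exists_parametrization hD hx
  obtain ⟨s, hs, hsd⟩ := exists_hasDerivAt_sqrt_sub hD hDc hζ
  have hs0 : ∀ z ∈ D, s z ≠ 0 := fun z hz ↦ (hsd z hz).1
  have hadd : ∀ z ∈ D, s x + s z ≠ 0 := fun z hz ↦ add_ne_zero_of_sq_eq_sub hs hs0 hx
  have h0 : ball (0 : ℂ) 1 ∈ 𝓝 0 := ball_mem_nhds 0 one_pos
  -- `β z * β w = 1` would force `s x * (s z + s w) = 0`, which the disjointness of `s` and `-s`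
  -- excludes.
  set β : ℂ → ℂ := fun z ↦ (s x - s z) / (s x + s z)
  have hβd : ∀ z ∈ D, HasDerivAt β ((-(1 / (2 * s z)) * (s x + s z) -
      (s x - s z) * (1 / (2 * s z))) / (s x + s z) ^ 2) z := fun z hz ↦
    ((hsd z hz).2.const_sub (s x)).div ((hsd z hz).2.const_add (s x)) (hadd z hz)
  have hβi : InjOn β D := by
    intro z hz w hw h
    refine injective_of_sq_eq_sub hs ?_
    rw [div_eq_div_iff (hadd z hz) (hadd w hw)] at h
    have h1 : s x * (s w - s z) = 0 := by linear_combination h / 2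
    rcases mul_eq_zero.mp h1 with h2 | h2
    · exact absurd h2 (hs0 x hx)
    · exact (sub_eq_zero.mp h2).symm
  have hβBE : ∀ z ∈ D, ∀ w ∈ D, β z * β w ≠ 1 := by
    intro z hz w hw h
    rw [div_mul_div_comm, div_eq_one_iff_eq (mul_ne_zero (hadd z hz) (hadd w hw))] at h
    have h1 : s x * (s z + s w) = 0 := by linear_combination -h / 2
    exact mul_ne_zero (hs0 x hx) (add_ne_zero_of_sq_eq_sub hs hs0 hz) h1
  have hle := norm_deriv_le_one_of_mul_ne_one (b := β ∘ φ)
    (fun t ht ↦ ((hβd _ (hφm ht)).differentiableAt.comp t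
      (hφd.differentiableAt (isOpen_ball.mem_nhds ht))).differentiableWithinAt)
    (hβi.comp hφi hφm) (by simp [β, hφ0])
    (fun z hz w hw ↦ hβBE _ (hφm hz) _ (hφm hw))
  have key := mul_le_norm_deriv_of_norm_deriv_comp_le_one (hφd.differentiableAt h0) hφ0 hφ
    (hβd x hx) hle
  have hx0 := hs0 x hx
  have hval : (-(1 / (2 * s x)) * (s x + s x) - (s x - s x) * (1 / (2 * s x))) /
      (s x + s x) ^ 2 = -(1 / 4 / (x - ζ)) := by
    rw [← hs x]
    field_simp
    ring
  rw [hval, norm_neg, norm_div] at key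
  simpa using key

/-- The hyperbolic density of a convex domain is bounded below by that of a half-plane. -/
theorem IsBiholomorphic.one_div_two_mul_le_norm_deriv {D : Set ℂ} {f : ℂ → ℂ} (hD : IsOpen D)
    (hDc : Convex ℝ D) (hf : IsBiholomorphic f D unitDisk) {x ζ : ℂ} (hx : x ∈ D)
    (hζ : ζ ∉ D) : 1 / 2 / ‖x - ζ‖ * (1 - ‖f x‖ ^ 2) ≤ ‖deriv f x‖ := by
  obtain ⟨φ, hφd, hφm, -, hφ0, hφ⟩ := hf.exists_parametrization hD hx
  have h0 : ball (0 : ℂ) 1 ∈ 𝓝 0 := ball_mem_nhds 0 one_pos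
  -- Separating `ζ` from `D` places `D` in the half-plane `Re (c (z - ζ)) > 0`; `β` below is its
  -- Cayley map to the disk, vanishing at `x`.
  obtain ⟨ℓ, hℓ⟩ := RCLike.geometric_hahn_banach_open_point (𝕜 := ℂ) hDc hD hζ
  set c : ℂ := -ℓ 1
  have hℓc : ∀ z, ℓ z = -(c * z) := fun z ↦ by
    have : ℓ (z • 1) = z • ℓ 1 := map_smul ℓ z 1
    rw [smul_eq_mul, mul_one, smul_eq_mul] at this
    rw [this]; simp only [c]; ring
  have hre : ∀ z ∈ D, 0 < (c * (z - ζ)).re := fun z hz ↦ by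
    have := hℓ z hz
    rw [hℓc, hℓc] at this
    simp only [RCLike.re_eq_complex_re, neg_re] at this
    rw [mul_sub, sub_re]
    linarith
  set p : ℂ := c * (x - ζ)
  have hp : 0 < p.re := hre x hx
  have hden : ∀ z ∈ D, conj p + c * (z - ζ) ≠ 0 := fun z hz h ↦ by
    have := congrArg re h
    rw [add_re, conj_re, zero_re] at this
    linarith [hre z hz]
  set β : ℂ → ℂ := fun z ↦ (p - c * (z - ζ)) / (conj p + c * (z - ζ))
  have hlin : ∀ z, HasDerivAt (fun z ↦ c * (z - ζ)) c z := fun z ↦ by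
    simpa using ((hasDerivAt_id z).sub_const ζ).const_mul c
  have hβd : ∀ z ∈ D, HasDerivAt β ((-c * (conj p + c * (z - ζ)) -
      (p - c * (z - ζ)) * c) / (conj p + c * (z - ζ)) ^ 2) z := fun z hz ↦
    ((hlin z).const_sub p).div ((hlin z).const_add (conj p)) (hden z hz)
  have hβm : MapsTo β D (ball 0 1) := fun z hz ↦ by
    rw [mem_ball_zero_iff, norm_div, div_lt_one (norm_pos_iff.mpr (hden z hz)),
      ← sq_lt_sq₀ (norm_nonneg _) (norm_nonneg _), ← normSq_eq_norm_sq, ← normSq_eq_norm_sq]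
    have hz' := hre z hz
    simp only [normSq_apply, sub_re, sub_im, add_re, add_im, conj_re, conj_im]
    nlinarith [mul_pos hp hz']
  have hle : ‖deriv (β ∘ φ) 0‖ ≤ 1 := by
    refine norm_deriv_le_one_of_mapsTo_ball (R := 1) (fun t ht ↦
      ((hβd _ (hφm ht)).differentiableAt.comp t
        (hφd.differentiableAt (isOpen_ball.mem_nhds ht))).differentiableWithinAt) ?_ one_pos
    have : (β ∘ φ) 0 = 0 := by simp [β, hφ0, p]
    rw [this]
    exact (hβm.comp hφm).mono_right ball_subset_closedBall
  have key := mul_le_norm_deriv_of_norm_deriv_comp_le_one (hφd.differentiableAt h0) hφ0 hφ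
    (hβd x hx) hle
  have hsum : conj p + p = (2 * p.re : ℝ) := by rw [add_comm, add_conj]
  have hval : ‖(-c * (conj p + p) - (p - p) * c) / (conj p + p) ^ 2‖ = ‖c‖ / (2 * p.re) := by
    have h2 : ((2 * p.re : ℝ) : ℂ) ≠ 0 := ofReal_ne_zero.mpr (by positivity)
    rw [hsum, sub_self, zero_mul, sub_zero, sq, mul_div_mul_right _ _ h2, norm_div, norm_neg,
      norm_real, Real.norm_of_nonneg (by positivity)]
  have hpos : 0 ≤ 1 - ‖f x‖ ^ 2 := hφ ▸ by positivity
  have hxζ : 0 < ‖x - ζ‖ := norm_pos_iff.mpr (sub_ne_zero.mpr (ne_of_mem_of_not_mem hx hζ))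
  have hdist : 1 / 2 / ‖x - ζ‖ ≤ ‖c‖ / (2 * p.re) := by
    have : p.re ≤ ‖c‖ * ‖x - ζ‖ := (re_le_norm p).trans (norm_mul _ _).le
    rw [div_div, div_le_div_iff₀ (by positivity) (by positivity)]
    linarith
  calc _ ≤ ‖c‖ / (2 * p.re) * (1 - ‖f x‖ ^ 2) := by gcongr
    _ ≤ _ := by rw [← hval]; exact key

/-! ### Riemann maps of symmetric domains. -/

theorem IsBiholomorphic.injOn {f : ℂ → ℂ} {U V : Set ℂ} (hf : IsBiholomorphic f U V) :
    InjOn f U := by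
  obtain ⟨-, g, -, hgf, -⟩ := hf
  exact LeftInvOn.injOn (f₁' := g) fun z hz ↦ hgf z hz

theorem IsBiholomorphic.const_mul {f : ℂ → ℂ} {U : Set ℂ} (hf : IsBiholomorphic f U unitDisk)
    {u : ℂ} (hu : ‖u‖ = 1) : IsBiholomorphic (fun z ↦ u * f z) U unitDisk := by
  obtain ⟨⟨hfd, hfm⟩, g, ⟨hgd, hgm⟩, hgf, hfg⟩ := hf
  have hu0 : u ≠ 0 := norm_ne_zero_iff.mp (by rw [hu]; exact one_ne_zero)
  have hm : MapsTo (fun z ↦ u⁻¹ * z) unitDisk unitDisk := fun z hz ↦ by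
    simpa [unitDisk, hu] using hz
  refine ⟨⟨hfd.const_mul u, fun z hz ↦ ?_⟩, g ∘ fun z ↦ u⁻¹ * z,
    ⟨hgd.comp (by fun_prop) hm, hgm.comp hm⟩, fun z hz ↦ ?_, fun z hz ↦ ?_⟩
  · simpa [unitDisk, hu] using hfm hz
  · simp [hu0, hgf z hz]
  · simp [hu0, hfg _ (hm hz)]

/-- A Riemann map of a symmetric domain can be rotated so that it is real on the real axis. -/
theorem exists_isBiholomorphic_conj_eq {D : Set ℂ} (hD : IsNiceDomain D) (hDne : D ≠ univ)
    (h0 : (0 : ℂ) ∈ D) :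
    ∃ f, IsBiholomorphic f D unitDisk ∧ f 0 = 0 ∧
      ∀ x : ℝ, (x : ℂ) ∈ D → f x = ((f x).re : ℂ) := by
  obtain ⟨f, hf, hf0⟩ := exists_isBiholomorphic_unitDisk hD.isOpen hD.isSimplyConnected hDne h0
  have hf' := hf
  obtain ⟨⟨hfd, hfm⟩, g, ⟨hgd, hgm⟩, hgf, hfg⟩ := hf'
  rw [unitDisk_eq_ball] at hfm hgd hgm hfg
  set h : ℂ → ℂ := conj ∘ f ∘ conj
  have hhd : DifferentiableOn ℂ h D := fun z hz ↦
    (differentiableAt_conj_conj_iff.mpr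
      (hfd.differentiableAt (hD.isOpen.mem_nhds (hD.symmetric z hz)))).differentiableWithinAt
  have hhm : MapsTo h D (ball 0 1) := fun z hz ↦ by
    simpa [h] using hfm (hD.symmetric z hz)
  set φ : ℂ → ℂ := h ∘ g
  have hφd : DifferentiableOn ℂ φ (ball 0 1) := hhd.comp hgd hgm
  have hφm : MapsTo φ (ball 0 1) (closedBall 0 1) :=
    (hhm.comp hgm).mono_right ball_subset_closedBall
  have hφf : ∀ z ∈ D, φ (f z) = h z := fun z hz ↦ by simp [φ, hgf z hz]
  have hφ0 : φ 0 = 0 := by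
    rw [← hf0, hφf 0 h0]; simp [h, hf0]
  have hle : ∀ z ∈ D, ‖h z‖ ≤ ‖f z‖ := fun z hz ↦ by
    rw [← hφf z hz]
    exact norm_le_norm_of_mapsTo_ball hφd hφm hφ0 (mem_ball_zero_iff.mp (hfm hz))
  have hnorm : ∀ z, ‖h z‖ = ‖f (conj z)‖ := fun z ↦ RCLike.norm_conj _
  have hw : (1 / 2 : ℂ) ∈ ball (0 : ℂ) 1 := by rw [mem_ball_zero_iff]; norm_num
  have hz := hgm hw
  -- The inequality `‖h z‖ ≤ ‖f z‖`, used at the conjugate point, reverses itself; equality in the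
  -- Schwarz lemma then makes `φ` a rotation by some `c`.
  have heq : ‖φ (1 / 2)‖ = ‖(1 / 2 : ℂ)‖ := by
    refine le_antisymm (norm_le_norm_of_mapsTo_ball hφd hφm hφ0 (mem_ball_zero_iff.mp hw)) ?_
    have := hle _ (hD.symmetric _ hz)
    rwa [hnorm, conj_conj, hfg _ hw, ← hnorm] at this
  have hs : ‖dslope φ 0 (1 / 2)‖ = 1 / 1 := by
    rw [dslope_of_ne _ (by norm_num), slope_def_field, hφ0, sub_zero, sub_zero, norm_div, heq,
      div_self (by norm_num), div_one]
  have haff := affine_of_mapsTo_ball_of_norm_dslope_eq_div hφd (by rwa [hφ0]) hw hs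
  set c := dslope φ 0 (1 / 2)
  have hhc : ∀ z ∈ D, conj (f (conj z)) = f z * c := fun z hz ↦ by
    have := haff (hfm hz)
    rw [hφf z hz, hφ0] at this
    simpa [h] using this
  -- With `u ^ 2 = c`, the relation `conj (f x) = c * f x` for real `x` says that `u * f x` is real.
  obtain ⟨u, hu⟩ := IsAlgClosed.exists_pow_nat_eq c two_pos
  have hun : ‖u‖ = 1 := by
    have : ‖u‖ ^ 2 = 1 := by rw [← norm_pow, hu, hs]; norm_num
    exact (pow_eq_one_iff_of_nonneg (norm_nonneg u) two_ne_zero).mp this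
  refine ⟨_, hf.const_mul hun, by simp [hf0], fun x hx ↦ ?_⟩
  have h1 := hhc x hx
  rw [conj_ofReal, ← hu] at h1
  have h2 : conj u * u = 1 := by
    rw [← normSq_eq_conj_mul_self, normSq_eq_norm_sq, hun]; norm_num
  refine (conj_eq_iff_re.mp ?_).symm
  rw [map_mul, h1]
  linear_combination (u * f x) * h2

/-- A normalised Riemann map which is real on the real axis. -/
theorem exists_isNormalizedRiemannMap {D : Set ℂ} (hD : IsNiceDomain D) (hDne : D ≠ univ)
    (hI : ∀ x ∈ Icc (-1 : ℝ) 1, (x : ℂ) ∈ D) :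
    ∃ f, IsNormalizedRiemannMap D f ∧ ∀ x : ℝ, (x : ℂ) ∈ D → f x = ((f x).re : ℂ) := by
  have h0 : (0 : ℂ) ∈ D := by simpa using hI 0 (by simp)
  obtain ⟨f, hf, hf0, hreal⟩ := exists_isBiholomorphic_conj_eq hD hDne h0
  have hI' : ∀ x ∈ Icc (0 : ℝ) 1, (x : ℂ) ∈ D := fun x hx ↦ hI x ⟨by linarith [hx.1], hx.2⟩
  have hcont : ContinuousOn (fun x : ℝ ↦ (f x).re) (Icc 0 1) :=
    continuous_re.comp_continuousOn
      (hf.1.1.continuousOn.comp continuous_ofReal.continuousOn hI')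
  have hinj : InjOn (fun x : ℝ ↦ (f x).re) (Icc 0 1) := fun x hx y hy h ↦ by
    have : f x = f y := by
      rw [hreal x (hI' x hx), hreal y (hI' y hy)]; exact congrArg ofReal h
    exact ofReal_injective (hf.injOn (hI' x hx) (hI' y hy) this)
  have hlt : ∀ x ∈ Icc (0 : ℝ) 1, |(f x).re| < 1 := fun x hx ↦
    (abs_re_le_norm _).trans_lt (hf.1.2 (hI' x hx))
  have hz : (0 : ℝ) ∈ Icc (0 : ℝ) 1 := by simp
  rcases hcont.strictMonoOn_of_injOn_Icc' zero_le_one hinj with hmono | hanti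
  · refine ⟨f, ⟨hf, hf0, fun x hx ↦ ⟨(f x).re, ⟨?_, (abs_lt.mp (hlt x hx)).2⟩,
      hreal x (hI' x hx)⟩⟩, hreal⟩
    simpa [hf0] using hmono.monotoneOn hz hx hx.1
  · have hreal' : ∀ x : ℝ, (x : ℂ) ∈ D → -1 * f x = ((-1 * f x).re : ℂ) := fun x hx ↦ by
      rw [hreal x hx]; simp
    refine ⟨fun z ↦ -1 * f z, ⟨hf.const_mul (by simp), by simp [hf0], fun x hx ↦
      ⟨(-1 * f x).re, ⟨?_, ?_⟩, hreal' x (hI' x hx)⟩⟩, hreal'⟩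
    · simpa [hf0] using hanti.antitoneOn hz hx hx.1
    · have := (abs_lt.mp (hlt x hx)).1
      simp
      linarith

/-! ### From the density to the distance on the real segment. -/

/-- On real points `p` is the difference of `artanh` values, because `m` obeys the subtraction
formula of `tanh`. -/
theorem poincareDist_ofReal {s t : ℝ} (hs : |s| < 1) (ht : |t| < 1) :
    poincareDist s t = |1 / 2 * (Real.log (1 + s) - Real.log (1 - s)) -
      1 / 2 * (Real.log (1 + t) - Real.log (1 - t))| := by
  wlog hts : t ≤ s generalizing s t
  · rw [abs_sub_comm, ← this ht hs (not_le.mp hts).le, poincareDist, poincareDist]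
    have : mobiusDist s t = mobiusDist t s := by
      rw [mobiusDist, mobiusDist, norm_div, norm_div, norm_sub_rev, conj_ofReal, conj_ofReal,
        mul_comm]
    rw [this]
  obtain ⟨hs1, hs2⟩ := abs_lt.mp hs
  obtain ⟨ht1, ht2⟩ := abs_lt.mp ht
  have h1 : 0 < 1 - s * t := by nlinarith
  have hm : mobiusDist s t = (s - t) / (1 - s * t) := by
    rw [mobiusDist, conj_ofReal]
    have : ((s : ℂ) - t) / (1 - s * t) = (((s - t) / (1 - s * t) : ℝ) : ℂ) := by push_cast; rfl
    rw [this, norm_real, Real.norm_of_nonneg (div_nonneg (sub_nonneg.mpr hts) h1.le)]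
  have hq : (1 + mobiusDist s t) / (1 - mobiusDist s t) =
      ((1 + s) * (1 - t)) / ((1 - s) * (1 + t)) := by
    have e1 : 1 + mobiusDist s t = (1 + s) * (1 - t) / (1 - s * t) := by
      rw [hm]; field_simp; ring
    have e2 : 1 - mobiusDist s t = (1 - s) * (1 + t) / (1 - s * t) := by
      rw [hm]; field_simp; ring
    rw [e1, e2, div_div_div_cancel_right₀ h1.ne']
  have a1 : 0 < 1 + s := by linarith
  have a2 : 0 < 1 - s := by linarith
  have a3 : 0 < 1 + t := by linarith
  have a4 : 0 < 1 - t := by linarith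
  rw [poincareDist, hq, Real.log_div (by positivity) (by positivity),
    Real.log_mul a1.ne' a4.ne', Real.log_mul a2.ne' a3.ne', abs_of_nonneg]
  · ring
  · have := Real.log_le_log a3 (by linarith : 1 + t ≤ 1 + s)
    have := Real.log_le_log a2 (by linarith : 1 - s ≤ 1 - t)
    linarith

/-- Integrating a lower bound for the hyperbolic density along a real segment mapped to the
real axis. -/
theorem mul_abs_sub_le_poincareDist {D : Set ℂ} {f : ℂ → ℂ} (hD : IsOpen D)
    (hf : f ∈ holomorphicMaps D unitDisk) (hreal : ∀ x : ℝ, (x : ℂ) ∈ D → f x = ((f x).re : ℂ))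
    {c w z : ℝ} (hwz : ∀ x ∈ uIcc w z, (x : ℂ) ∈ D)
    (hc : ∀ x ∈ uIcc w z, c * (1 - ‖f x‖ ^ 2) ≤ ‖deriv f x‖) :
    c * |w - z| ≤ poincareDist (f w) (f z) := by
  wlog hlt : w ≤ z generalizing w z
  · have h1 := this (w := z) (z := w) (by rwa [uIcc_comm]) (by rwa [uIcc_comm]) (not_le.mp hlt).le
    have hm : mobiusDist (f w) (f z) = mobiusDist (f z) (f w) := by
      rw [hreal w (hwz w left_mem_uIcc), hreal z (hwz z right_mem_uIcc), mobiusDist, mobiusDist,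
        norm_div, norm_div, norm_sub_rev, conj_ofReal, conj_ofReal, mul_comm]
    rwa [abs_sub_comm, poincareDist, hm]
  have hlt1 : ∀ x ∈ uIcc w z, |(f x).re| < 1 := fun x hx ↦
    (abs_re_le_norm _).trans_lt (hf.2 (hwz x hx))
  set ψ : ℝ → ℝ := fun x ↦ 1 / 2 * (Real.log (1 + (f x).re) - Real.log (1 - (f x).re))
  have hp : poincareDist (f w) (f z) = |ψ w - ψ z| := by
    rw [hreal w (hwz w left_mem_uIcc), hreal z (hwz z right_mem_uIcc)]
    exact poincareDist_ofReal (hlt1 w left_mem_uIcc) (hlt1 z right_mem_uIcc)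
  rw [hp]
  rcases hlt.eq_or_lt with rfl | hlt
  · simp
  have hψ : ∀ x ∈ uIcc w z, HasDerivAt ψ ((deriv f x).re / (1 - (f x).re ^ 2)) x := by
    intro x hx
    obtain ⟨h1, h2⟩ := abs_lt.mp (hlt1 x hx)
    have hre : HasDerivAt (fun y : ℝ ↦ (f y).re) (deriv f x).re x :=
      (hf.1.differentiableAt (hD.mem_nhds (hwz x hx))).hasDerivAt.real_of_complex
    have a1 : 1 + (f x).re ≠ 0 := by linarith
    have a2 : 1 - (f x).re ≠ 0 := by linarith
    refine ((((hre.const_add 1).log a1).sub ((hre.const_sub 1).log a2)).const_mul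
      (1 / 2)).congr_deriv ?_
    have a3 : 1 - (f x).re ^ 2 ≠ 0 := by
      rw [show 1 - (f x).re ^ 2 = (1 + (f x).re) * (1 - (f x).re) by ring]
      exact mul_ne_zero a1 a2
    field_simp
    ring
  have hIcc : uIcc w z = Icc w z := uIcc_of_le hlt.le
  -- The mean value theorem for `ψ = artanh ∘ f` suffices: the density bound at the single point `ξ`
  -- controls the whole increment.
  obtain ⟨ξ, hξ, heq⟩ := exists_hasDerivAt_eq_slope ψ
    (fun x ↦ (deriv f x).re / (1 - (f x).re ^ 2)) hlt
    (fun x hx ↦ (hψ x (hIcc ▸ hx)).continuousAt.continuousWithinAt)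
    (fun x hx ↦ hψ x (hIcc ▸ Ioo_subset_Icc_self hx))
  have hξ' : ξ ∈ uIcc w z := hIcc ▸ Ioo_subset_Icc_self hξ
  have hξD := hwz ξ hξ'
  -- `f` is real along the axis near `ξ`, so `|Re f'|` is the full modulus and `|ψ'|` is the
  -- density.
  have him : (deriv f ξ).im = 0 := by
    have h1 : HasDerivAt (fun y : ℝ ↦ (f y).im) (deriv f ξ).im ξ :=
      imCLM.hasFDerivAt.comp_hasDerivAt ξ
        (hf.1.differentiableAt (hD.mem_nhds hξD)).hasDerivAt.comp_ofReal
    refine h1.unique ((hasDerivAt_const ξ (0 : ℝ)).congr_of_eventuallyEq ?_)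
    filter_upwards [continuous_ofReal.continuousAt.preimage_mem_nhds (hD.mem_nhds hξD)] with y hy
    rw [hreal y hy, ofReal_im]
  have hn1 : ‖deriv f ξ‖ = |(deriv f ξ).re| := (abs_re_eq_norm.mpr him).symm
  have hn2 : ‖f ξ‖ ^ 2 = (f ξ).re ^ 2 := by
    rw [hreal ξ hξD, norm_real, Real.norm_eq_abs, sq_abs, ofReal_re]
  have hpos : 0 < 1 - (f ξ).re ^ 2 := by
    have := hlt1 ξ hξ'
    rw [← sq_abs]
    nlinarith [abs_nonneg (f ξ).re]
  have hcξ := hc ξ hξ'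
  rw [hn1, hn2, ← le_div_iff₀ hpos, ← abs_of_pos hpos, ← abs_div, heq, abs_div,
    le_div_iff₀ (abs_pos.mpr (sub_ne_zero.mpr hlt.ne'))] at hcξ
  rwa [abs_sub_comm w, abs_sub_comm (ψ w)]

/-- Rewriting the hypothesis as `L / γ ≤ |x - ζ|` passes it to the infimum directly. A point outside
`D` makes that infimum genuine, gives `γ > 0`, and bounds the supremum over `x`. -/
theorem div_boundaryDist_le {D : Set ℂ} (hDne : D ≠ univ) {L γ x : ℝ} (hL : 0 < L)
    (hx : x ∈ Icc (-1 : ℝ) 1) (hxD : (x : ℂ) ∈ D)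
    (hγ : ∀ ζ ∉ D, L / ‖(x : ℂ) - ζ‖ ≤ γ) : L / boundaryDist D ≤ γ := by
  obtain ⟨ζ₀, hζ₀⟩ := (ne_univ_iff_exists_notMem D).mp hDne
  have hpos : ∀ ζ ∉ D, 0 < ‖(x : ℂ) - ζ‖ := fun ζ hζ ↦
    norm_pos_iff.mpr (sub_ne_zero.mpr (ne_of_mem_of_not_mem hxD hζ))
  have hγ0 : 0 < γ := (div_pos hL (hpos ζ₀ hζ₀)).trans_le (hγ ζ₀ hζ₀)
  have h1 : L / γ ≤ boundaryDistAt D x := by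
    refine le_csInf ⟨_, ζ₀, hζ₀, rfl⟩ ?_
    rintro _ ⟨ζ, hζ, rfl⟩
    rw [div_le_iff₀ hγ0, mul_comm, ← div_le_iff₀ (hpos ζ hζ)]
    exact hγ ζ hζ
  have hbdd : BddAbove {r : ℝ | ∃ x ∈ Icc (-1 : ℝ) 1, r = boundaryDistAt D (x : ℂ)} := by
    refine ⟨1 + ‖ζ₀‖, ?_⟩
    rintro _ ⟨y, hy, rfl⟩
    have hle : boundaryDistAt D (y : ℂ) ≤ ‖(y : ℂ) - ζ₀‖ :=
      csInf_le ⟨0, by rintro _ ⟨ζ, -, rfl⟩; exact norm_nonneg _⟩ ⟨ζ₀, hζ₀, rfl⟩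
    have hy1 : ‖(y : ℂ)‖ ≤ 1 := by rw [norm_real, Real.norm_eq_abs]; exact abs_le.mpr hy
    linarith [norm_sub_le (y : ℂ) ζ₀]
  have h2 : boundaryDistAt D x ≤ boundaryDist D := le_csSup hbdd ⟨x, hx, rfl⟩
  have h3 : 0 < boundaryDist D := (div_pos hL hγ0).trans_le (h1.trans h2)
  rw [div_le_iff₀ h3, mul_comm, ← div_le_iff₀ hγ0]
  exact h1.trans h2

theorem exp_two_mul_sub_one_div_eq_tanh (y : ℝ) :
    (Real.exp (2 * y) - 1) / (Real.exp (2 * y) + 1) = Real.tanh y := by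
  rw [Real.tanh_eq_sinh_div_cosh, Real.sinh_eq, Real.cosh_eq, two_mul, Real.exp_add, Real.exp_neg]
  have := Real.exp_pos y
  field_simp

theorem monotone_tanh : Monotone Real.tanh := fun x y h ↦ by
  rwa [← Real.artanh_le_artanh_iff ⟨Real.neg_one_lt_tanh x, Real.tanh_lt_one x⟩
    ⟨Real.neg_one_lt_tanh y, Real.tanh_lt_one y⟩, Real.artanh_tanh, Real.artanh_tanh]

theorem mainTheorem5 (D : Set ℂ) (hD : IsNiceDomain D) (hDne : D ≠ Set.univ)
    (hI : ∀ x ∈ Set.Icc (-1 : ℝ) 1, (x : ℂ) ∈ D) :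
    (∃ f : ℂ → ℂ, IsNormalizedRiemannMap D f) ∧
    ∀ L : ℝ, (L = 1 / 4 ∨ (L = 1 / 2 ∧ Convex ℝ D)) →
      ∀ w ∈ Set.Icc (-1 : ℝ) 1, ∀ z ∈ Set.Icc (-1 : ℝ) 1,
        caratheodoryDist D w z ≥ L / boundaryDist D * |w - z| ∧
        ∀ f : ℂ → ℂ, IsNormalizedRiemannMap D f →
          mobiusDist (f w) (f z) = caratheodoryStar D w z ∧
          caratheodoryStar D w z = Real.tanh (caratheodoryDist D w z) ∧
          Real.tanh (caratheodoryDist D w z) ≥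
            (Real.exp (2 * L * |w - z| / boundaryDist D) - 1) /
              (Real.exp (2 * L * |w - z| / boundaryDist D) + 1) ∧
          (Real.exp (2 * L * |w - z| / boundaryDist D) - 1) /
              (Real.exp (2 * L * |w - z| / boundaryDist D) + 1) =
            Real.tanh (L * |w - z| / boundaryDist D) := by
  -- The lower bound uses this one map, real on all of `D ∩ ℝ`; an arbitrary normalised `f` only
  -- enters the identity for `tanh c_D`, where any biholomorphism serves.
  obtain ⟨F, hF, hreal⟩ := exists_isNormalizedRiemannMap hD hDne hI
  refine ⟨⟨F, hF⟩, fun L hL w hw z hz ↦ ?_⟩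
  have hFb := hF.isBiholomorphic
  have hL0 : 0 < L := by rcases hL with rfl | ⟨rfl, -⟩ <;> norm_num
  have hdens : ∀ x ∈ D, ∀ ζ ∉ D, L / ‖x - ζ‖ * (1 - ‖F x‖ ^ 2) ≤ ‖deriv F x‖ := by
    intro x hx ζ hζ
    rcases hL with rfl | ⟨rfl, hconv⟩
    · exact hFb.one_div_four_mul_le_norm_deriv hD.isOpen hD.isSimplyConnected hx hζ
    · exact hFb.one_div_two_mul_le_norm_deriv hD.isOpen hconv hx hζ
  have hsub : uIcc w z ⊆ Icc (-1) 1 := uIcc_subset_Icc hw hz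
  have hcar : L / boundaryDist D * |w - z| ≤ caratheodoryDist D w z := by
    rw [caratheodoryDist_eq_poincareDist hFb (hI w hw) (hI z hz)]
    refine mul_abs_sub_le_poincareDist hD.isOpen hFb.1 hreal (fun x hx ↦ hI x (hsub hx))
      fun x hx ↦ ?_
    have hxD := hI x (hsub hx)
    have hlt : ‖F x‖ < 1 := hFb.1.2 hxD
    have hpos : 0 < 1 - ‖F x‖ ^ 2 := by nlinarith [norm_nonneg (F x)]
    rw [← le_div_iff₀ hpos]
    refine div_boundaryDist_le hDne hL0 (hsub hx) hxD fun ζ hζ ↦ ?_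
    rw [le_div_iff₀ hpos]
    exact hdens x hxD ζ hζ
  have htanh : (Real.exp (2 * L * |w - z| / boundaryDist D) - 1) /
      (Real.exp (2 * L * |w - z| / boundaryDist D) + 1) =
        Real.tanh (L * |w - z| / boundaryDist D) := by
    rw [← exp_two_mul_sub_one_div_eq_tanh, mul_assoc, mul_div_assoc]
  refine ⟨hcar, fun f hf ↦ ⟨?_, rfl, ?_, htanh⟩⟩
  · have hfb := hf.isBiholomorphic
    rw [caratheodoryStar, caratheodoryDist_eq_poincareDist hfb (hI w hw) (hI z hz),
      tanh_poincareDist (hfb.1.2 (hI w hw)) (hfb.1.2 (hI z hz))]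
  · rw [htanh, mul_div_right_comm]
    exact monotone_tanh hcar
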